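/- **Setting.** For $\mathcal A\in\mathbb R^{n_1\times n_2\times n_3}$ let $\widehat{\mathcal A}$ be the tensor obtained by applying the orthonormal (type II) discrete cosine transform to every tube $\mathcal A(i,j,:)$, let $\widehat{\mathcal A}^{(k)}$ be its $k$-th frontal slice and $\overline{\mathcal A}=\operatorname{blockdiag}(\widehat{\mathcal A}^{(1)},\dots,\widehat{\mathcal A}^{(n_3)})$. The product $\mathcal A*\mathcal B$ and the transpose $\mathcal A^T$ are defined slicewise in the transform domain: $\overline{\mathcal A*\mathcal B}=\overline{\mathcal A}\,\overline{\mathcal B}$, $\overline{\mathcal A^T}=\overline{\mathcal A}^T$. The transformed multi-rank is $\operatorname{rank}_t(\mathcal A)=(\operatorname{rank}\widehat{\mathcal A}^{(k)})_{k}$, and $\sigma_{\min}(\mathcal A)$ is the smallest nonzero singular value of $\overline{\mathcal A}$. For a multi-rank $\mathbf r=(r_1,\dots,r_{n_3})$ put $r=\max_k r_k$, and let $\mathcal I_{\mathbf r}\in\mathbb R^{r\times r\times n_3}$ be the tensor with $\widehat{\mathcal I_{\mathbf r}}^{(k)}=\operatorname{diag}(I_{r_k},0)$. A skinny $t_c$-SVD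 of a tensor of multi-rank $\mathbf r$ is $\mathcal A=\mathcal U*\mathcal S*\mathcal V^T$ with $\mathcal U\in\mathbb R^{n_1\times r\times n_3}$, $\mathcal V\in\mathbb R^{n_2\times r\times n_3}$ of multi-rank $\mathbf r$, $\mathcal U^T*\mathcal U=\mathcal V^T*\mathcal V=\mathcal I_{\mathbf r}$, and $\mathcal S\in\mathbb R^{r\times r\times n_3}$ with diagonal frontal slices. The associated tangent projection is $$P(\mathcal Z)=\mathcal U*\mathcal U^T*\mathcal Z+\mathcal Z*\mathcal V*\mathcal V^T-\mathcal U*\mathcal U^T*\mathcal Z*\mathcal V*\mathcal V^T.$$ The truncation $H_{\mathbf r}(\mathcal W)$ keeps, in an SVD of each $\widehat{\mathcal W}^{(k)}$, the $r_k$ largest singular values and the corresponding singular vectors (ties broken arbitrarily). Let $m\ge1$, let $\Omega=(\omega_1,\dots,\omega_m)$ be a family of index triples (repetitions allowed), $R_\Omega(\mathcal Z)=\sum_{t=1}^m\langle\mathcal E_{\omega_t},\mathcal Z\rangle\mathcal E_{\omega_t}$ with $\mathcal E_\omega$ the tensor whose only nonzero entry is a $1$ at position $\omega$, $p=m/(n_1n_2n_3)$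 and $n=\max\{n_1,n_2,n_3\}$. Norms of operators are operator norms with respect to $\|\cdot\|_F$. **Algorithm (restarted tensor Riemannian conjugate gradient descent, parameters $k_1,k_2\ge0$).** Start from $\mathcal X_0=\mathcal U_0*\mathcal S_0*\mathcal V_0^T$, a skinny $t_c$-SVD with $\operatorname{rank}_t(\mathcal X_0)=\mathbf r$, and put $\mathcal Q_{-1}=0$, $\beta_0=0$. For $l=0,1,\dots$, with $P_l$ the tangent projection given by $\mathcal U_l,\mathcal V_l$ (for $l\ge1$ the factors produced by the truncation), let $\mathcal G_l=R_\Omega(\mathcal X-\mathcal X_l)$; for $l\ge1$, let $\beta_l=-\frac{\langle P_l\mathcal G_l,\,R_\Omega P_l\mathcal Q_{l-1}\rangle}{\langle P_l\mathcal Q_{l-1},\,R_\Omega P_l\mathcal Q_{l-1}\rangle}$ if $$\frac{|\langle P_l\mathcal G_l,P_l\mathcal Q_{l-1}\rangle|}{\|P_l\mathcal G_l\|_F\|P_l\mathcal Q_{l-1}\|_F}\le k_1\quad\text{and}\quad \|P_l\mathcal G_l\|_F\le k_2\|P_l\mathcal Q_{l-1}\|_F,$$ and $\beta_l=0$ (restart)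 otherwise; then $$\mathcal Q_l=P_l\mathcal G_l+\beta_lP_l\mathcal Q_{l-1},\quad \alpha_l=\frac{\langle P_l\mathcal G_l,P_l\mathcal Q_l\rangle}{\langle P_l\mathcal Q_l,R_\Omega P_l\mathcal Q_l\rangle},\quad \mathcal W_l=\mathcal X_l+\alpha_l\mathcal Q_l,\quad \mathcal X_{l+1}=H_{\mathbf r}(\mathcal W_l).$$ (Quotients $0/0$ are read as $0$.) **Constants.** $$\gamma_1=\frac{18\epsilon_0-10k_1\epsilon_0(1+4\epsilon_0)}{(1-4\epsilon_0)-k_1(1+4\epsilon_0)}+\frac{4k_2\epsilon_0+k_1k_2}{1-4\epsilon_0},\quad \gamma_2=\frac{8k_2\epsilon_0+2k_1k_2}{1-4\epsilon_0},\quad v_{cg}=\tfrac12\Big(\gamma_1+\sqrt{\gamma_1^2+4\gamma_2}\Big).$$ **Theorem 3.1.** (a) Let $\mathcal X=\mathcal U*\mathcal S*\mathcal V^T$ be a skinny $t_c$-SVD with $\operatorname{rank}_t(\mathcal X)=\mathbf r$ and let $P_{\mathbb T}$ be the tangent projection given by $\mathcal U,\mathcal V$. Let $\beta>1$, $k_1,k_2\ge0$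 and $\epsilon_0>0$ satisfy $$\|R_\Omega\|\le\tfrac{10}3\beta\log n,\qquad \|P_{\mathbb T}-p^{-1}P_{\mathbb T}R_\Omega P_{\mathbb T}\|\le\epsilon_0,\qquad \frac{\|\mathcal X_0-\mathcal X\|_F}{\sigma_{\min}(\mathcal X)}\le\frac{3p^{1/2}\epsilon_0}{20\beta(1+\epsilon_0)\log n},$$ together with $(1-4\epsilon_0)-k_1(1+4\epsilon_0)>0$ and $\gamma_1+\gamma_2<1$. Then $v_{cg}<1$, and all iterates of the algorithm satisfy $$\|\mathcal X_l-\mathcal X\|_F\le v_{cg}^{\,l}\,\|\mathcal X_0-\mathcal X\|_F\qquad(l\ge0).$$ (b) If $k_1=k_2=0$ and $0<\epsilon_0<\frac14$, then $v_{cg}=\frac{18\epsilon_0}{1-4\epsilon_0}$, and this is $<1$ whenever $\gamma_1+\gamma_2<1$. (c) For $k_1,k_2\ge0$ with $k_1\ne1$, $\lim_{\epsilon_0\to0}(\gamma_1+\gamma_2)=3k_1k_2$. If $k_1,k_2\ge0$ and $k_1k_2<\frac13$, then $\gamma_1+\gamma_2<1$ for all sufficiently small $\epsilon_0>0$. (d)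 For $k_1=0.1$, $k_2=1$ and every $0<\epsilon_0\le0.01$, one has $(1-4\epsilon_0)-k_1(1+4\epsilon_0)>0$ and $\gamma_1+\gamma_2<1$. -/

import Mathlib

noncomputable section

open scoped InnerProductSpace

namespace TensorRCG

/-- Real third-order tensors of size `a × b × c`. The norm is the Frobenius norm and the inner
product is the entrywise one. The entry at position `(i, j, k)` of `A` is `A (i, j, k)`. -/
abbrev Tensor (a b c : ℕ) : Type := EuclideanSpace ℝ (Fin a × Fin b × Fin c)

/-- The tensor with prescribed entries. -/
def mk {a b c : ℕ} (f : Fin a → Fin b → Fin c → ℝ) : Tensor a b c :=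
  WithLp.toLp 2 fun x => f x.1 x.2.1 x.2.2

@[simp] theorem mk_apply {a b c : ℕ} (f : Fin a → Fin b → Fin c → ℝ)
    (x : Fin a × Fin b × Fin c) : mk f x = f x.1 x.2.1 x.2.2 := rfl

/-- The `k`-th frontal slice. -/
def slice {a b c : ℕ} (A : Tensor a b c) (k : Fin c) : Matrix (Fin a) (Fin b) ℝ :=
  Matrix.of fun i j => A (i, j, k)

/-! ### The discrete cosine transform -/

/-- The orthonormal (type II) discrete cosine transform matrix. -/
def dctMatrix (n : ℕ) : Matrix (Fin n) (Fin n) ℝ :=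
  Matrix.of fun k j =>
    Real.sqrt ((if k.val = 0 then 1 else 2) / n) *
      Real.cos (Real.pi * (2 * (j.val : ℝ) + 1) * k.val / (2 * n))

theorem sum_cos_odd (n : ℕ) (x : ℝ) :
    (∑ j : Fin n, Real.cos ((2 * (j.val : ℝ) + 1) * x)) * (2 * Real.sin x) =
      Real.sin (2 * n * x) := by
  rw [Fin.sum_univ_eq_sum_range (fun j : ℕ => Real.cos ((2 * (j : ℝ) + 1) * x))]
  induction n with
  | zero => simp
  | succ n ih =>
    rw [Finset.sum_range_succ, add_mul, ih]
    have h1 : 2 * ((n + 1 : ℕ) : ℝ) * x = (2 * (n : ℝ) + 1) * x + x := by push_cast; ring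
    have h2 : 2 * (n : ℝ) * x = (2 * (n : ℝ) + 1) * x - x := by ring
    rw [h1, h2, Real.sin_add, Real.sin_sub]
    ring

theorem sum_cos_int (n : ℕ) (m : ℤ) (h0 : m ≠ 0) (h1 : |m| < 2 * n) :
    ∑ j : Fin n, Real.cos ((2 * (j.val : ℝ) + 1) * (Real.pi * m / (2 * n))) = 0 := by
  have hn : 0 < n := by
    have := abs_nonneg m
    omega
  have hn' : (0 : ℝ) < n := by exact_mod_cast hn
  have key := sum_cos_odd n (Real.pi * m / (2 * n))
  have e : 2 * (n : ℝ) * (Real.pi * m / (2 * n)) = m * Real.pi := by field_simp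
  rw [e, Real.sin_int_mul_pi] at key
  have hs : Real.sin (Real.pi * m / (2 * n)) ≠ 0 := by
    intro hs
    rw [Real.sin_eq_zero_iff] at hs
    obtain ⟨q, hq⟩ := hs
    have hq' : (m : ℝ) = q * (2 * n) := by
      have hpi := Real.pi_ne_zero
      field_simp at hq
      linarith
    have hq2 : m = q * (2 * n) := by exact_mod_cast hq'
    have hq0 : q ≠ 0 := by
      rintro rfl
      exact h0 (by simpa using hq2)
    have : 1 ≤ |q| := Int.one_le_abs hq0
    rw [hq2, abs_mul, abs_of_nonneg (by positivity : (0 : ℤ) ≤ 2 * n)] at h1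
    nlinarith
  rcases mul_eq_zero.1 key with h | h
  · exact h
  · exact absurd (by linarith : Real.sin (Real.pi * m / (2 * n)) = 0) hs

/-- The cosine transform matrix is orthogonal. -/
theorem dctMatrix_mul_transpose (n : ℕ) : dctMatrix n * (dctMatrix n).transpose = 1 := by
  ext k l
  have hn : 0 < n := k.pos
  have hn' : (0 : ℝ) < n := by exact_mod_cast hn
  have split : ∀ j : Fin n,
      Real.cos (Real.pi * (2 * (j.val : ℝ) + 1) * k.val / (2 * n)) *
        Real.cos (Real.pi * (2 * (j.val : ℝ) + 1) * l.val / (2 * n)) =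
      (1 / 2) * (Real.cos ((2 * (j.val : ℝ) + 1) *
          (Real.pi * (((k.val : ℤ) - l.val : ℤ) : ℝ) / (2 * n))) +
        Real.cos ((2 * (j.val : ℝ) + 1) *
          (Real.pi * (((k.val : ℤ) + l.val : ℤ) : ℝ) / (2 * n)))) := by
    intro j
    have h1 : (2 * (j.val : ℝ) + 1) * (Real.pi * (((k.val : ℤ) - l.val : ℤ) : ℝ) / (2 * n)) =
        Real.pi * (2 * (j.val : ℝ) + 1) * k.val / (2 * n) -
          Real.pi * (2 * (j.val : ℝ) + 1) * l.val / (2 * n) := by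
      push_cast; ring
    have h2 : (2 * (j.val : ℝ) + 1) * (Real.pi * (((k.val : ℤ) + l.val : ℤ) : ℝ) / (2 * n)) =
        Real.pi * (2 * (j.val : ℝ) + 1) * k.val / (2 * n) +
          Real.pi * (2 * (j.val : ℝ) + 1) * l.val / (2 * n) := by
      push_cast; ring
    rw [h1, h2, Real.cos_sub, Real.cos_add]
    ring
  have expand : (dctMatrix n * (dctMatrix n).transpose) k l =
      Real.sqrt ((if k.val = 0 then 1 else 2) / n) *
        Real.sqrt ((if l.val = 0 then 1 else 2) / n) *
      ((1 / 2) * (∑ j : Fin n, Real.cos ((2 * (j.val : ℝ) + 1) *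
          (Real.pi * (((k.val : ℤ) - l.val : ℤ) : ℝ) / (2 * n))) +
        ∑ j : Fin n, Real.cos ((2 * (j.val : ℝ) + 1) *
          (Real.pi * (((k.val : ℤ) + l.val : ℤ) : ℝ) / (2 * n))))) := by
    rw [Matrix.mul_apply, ← Finset.sum_add_distrib, Finset.mul_sum, Finset.mul_sum]
    refine Finset.sum_congr rfl fun j _ => ?_
    rw [← split j]
    simp only [dctMatrix, Matrix.of_apply, Matrix.transpose_apply]
    ring
  rw [expand]
  have hk := k.isLt
  have hl := l.isLt
  by_cases hkl : k = l
  · subst hkl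
    rw [Matrix.one_apply_eq, Real.mul_self_sqrt (by positivity)]
    by_cases h0 : k.val = 0
    · simp [h0]
      field_simp
      norm_num
    · rw [sum_cos_int n ((k.val : ℤ) + k.val) (by omega)
        (by rw [abs_of_nonneg (by positivity)]; omega)]
      simp [h0]
      field_simp
  · have hne : k.val ≠ l.val := fun h => hkl (Fin.ext h)
    rw [Matrix.one_apply_ne hkl, sum_cos_int n ((k.val : ℤ) - l.val) (by omega)
      (by rw [abs_lt]; constructor <;> omega),
      sum_cos_int n ((k.val : ℤ) + l.val) (by omega)
        (by rw [abs_of_nonneg (by positivity)]; omega)]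
    simp

theorem transpose_mul_dctMatrix (n : ℕ) : (dctMatrix n).transpose * dctMatrix n = 1 :=
  mul_eq_one_comm.1 (dctMatrix_mul_transpose n)

/-- The cosine transform of all tubes (third dimension). -/
def dct {a b c : ℕ} (A : Tensor a b c) : Tensor a b c :=
  mk fun i j k => ∑ l, dctMatrix c k l * A (i, j, l)

/-- The inverse cosine transform of all tubes. -/
def idct {a b c : ℕ} (A : Tensor a b c) : Tensor a b c :=
  mk fun i j k => ∑ l, dctMatrix c l k * A (i, j, l)

theorem idct_dct {a b c : ℕ} (A : Tensor a b c) : idct (dct A) = A := by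
  ext ⟨i, j, k⟩
  have h := congrFun (congrArg Matrix.mulVec (transpose_mul_dctMatrix c)) (fun l => A (i, j, l))
  rw [← Matrix.mulVec_mulVec, Matrix.one_mulVec] at h
  exact congrFun h k

theorem dct_idct {a b c : ℕ} (A : Tensor a b c) : dct (idct A) = A := by
  ext ⟨i, j, k⟩
  have h := congrFun (congrArg Matrix.mulVec (dctMatrix_mul_transpose c)) (fun l => A (i, j, l))
  rw [← Matrix.mulVec_mulVec, Matrix.one_mulVec] at h
  exact congrFun h k

/-! ### The tensor algebra -/

/-- The block diagonal matrix of a tensor in the transform domain. -/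
def bdiag {a b c : ℕ} (A : Tensor a b c) : Matrix (Fin a × Fin c) (Fin b × Fin c) ℝ :=
  Matrix.blockDiagonal (slice (dct A))

/-- The tensor whose frontal slices are the diagonal blocks of a matrix. -/
def fold {a b c : ℕ} (M : Matrix (Fin a × Fin c) (Fin b × Fin c) ℝ) : Tensor a b c :=
  mk fun i j k => Matrix.blockDiag M k i j

/-- The `t_c`-product. -/
def tprod {a b d c : ℕ} (A : Tensor a b c) (B : Tensor b d c) : Tensor a d c :=
  idct (fold (bdiag A * bdiag B))

infixl:70 " ∗ₜ " => tprod

/-- The transpose of a tensor with respect to the cosine transform. -/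
def tr {a b c : ℕ} (A : Tensor a b c) : Tensor b a c :=
  idct (fold (bdiag A).transpose)

/-- The identity tensor with respect to the cosine transform. -/
def idTensor (a c : ℕ) : Tensor a a c :=
  idct (mk fun i j _ => if i = j then 1 else 0)

def IsOrthogonal {a c : ℕ} (A : Tensor a a c) : Prop :=
  tr A ∗ₜ A = idTensor a c ∧ A ∗ₜ tr A = idTensor a c

/-- Every frontal slice is a diagonal matrix. -/
def IsDiagonal {a b c : ℕ} (A : Tensor a b c) : Prop :=
  ∀ i j k, i.val ≠ j.val → A (i, j, k) = 0

/-- The transformed multi-rank. -/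
def multiRank {a b c : ℕ} (A : Tensor a b c) : Fin c → ℕ :=
  fun k => (slice (dct A) k).rank

/-- The largest entry of a multi-rank vector: the tubal rank. -/
def maxRank {c : ℕ} (r : Fin c → ℕ) : ℕ := Finset.univ.sup r

/-- The tensor of size `maxRank r × maxRank r × c` whose `k`-th frontal slice in the transform
domain is `diag (I_{r k}, 0)`. -/
def partialId {c : ℕ} (r : Fin c → ℕ) : Tensor (maxRank r) (maxRank r) c :=
  idct (mk fun i j k => if i = j ∧ i.val < r k then 1 else 0)

/-- The skinny `t_c`-SVD `A = U ∗ₜ S ∗ₜ Vᵀ` of a tensor `A` of transformed multi-rank `r`. -/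
structure IsSkinnySVD {a b c : ℕ} (r : Fin c → ℕ) (A : Tensor a b c)
    (U : Tensor a (maxRank r) c) (S : Tensor (maxRank r) (maxRank r) c)
    (V : Tensor b (maxRank r) c) : Prop where
  multiRank_eq : multiRank A = r
  eq : A = U ∗ₜ S ∗ₜ tr V
  left : tr U ∗ₜ U = partialId r
  right : tr V ∗ₜ V = partialId r
  multiRank_left : multiRank U = r
  multiRank_right : multiRank V = r
  diagonal : IsDiagonal S

/-- The full `t_c`-SVD: in the transform domain every frontal slice is a singular value
decomposition, with nonnegative singular values in nonincreasing order. -/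
structure IsFullSVD {a b c : ℕ} (A : Tensor a b c) (U : Tensor a a c) (S : Tensor a b c)
    (V : Tensor b b c) : Prop where
  eq : A = U ∗ₜ S ∗ₜ tr V
  left : IsOrthogonal U
  right : IsOrthogonal V
  diagonal : IsDiagonal S
  nonneg : ∀ (i : Fin a) (j : Fin b) (k : Fin c), i.val = j.val → 0 ≤ dct S (i, j, k)
  antitone : ∀ (i i' : Fin a) (j j' : Fin b) (k : Fin c), i.val = j.val → i'.val = j'.val →
    i.val ≤ i'.val → dct S (i', j', k) ≤ dct S (i, j, k)

/-- Keep, in the `k`-th frontal slice in the transform domain, the first `r k` columns (padded by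
zero columns to the common width `maxRank r`). -/
def truncCols {a c : ℕ} (r : Fin c → ℕ) (U : Tensor a a c) : Tensor a (maxRank r) c :=
  idct (mk fun i j k => if h : j.val < r k ∧ j.val < a then dct U (i, ⟨j.val, h.2⟩, k) else 0)

/-- Keep, in the `k`-th frontal slice in the transform domain, the first `r k` diagonal entries. -/
def truncDiag {a b c : ℕ} (r : Fin c → ℕ) (S : Tensor a b c) :
    Tensor (maxRank r) (maxRank r) c :=
  idct (mk fun i j k =>
    if h : i = j ∧ i.val < r k ∧ i.val < a ∧ j.val < b then
      dct S (⟨i.val, h.2.2.1⟩, ⟨j.val, h.2.2.2⟩, k) else 0)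

/-- `U`, `S`, `V` are the factors of a `t_c`-SVD of `W` truncated to multi-rank `r`; the truncation
of `W` is then `U ∗ₜ S ∗ₜ tr V`. -/
def IsTruncatedSVD {a b c : ℕ} (r : Fin c → ℕ) (W : Tensor a b c)
    (U : Tensor a (maxRank r) c) (S : Tensor (maxRank r) (maxRank r) c)
    (V : Tensor b (maxRank r) c) : Prop :=
  ∃ U' S' V', IsFullSVD W U' S' V' ∧ U = truncCols r U' ∧ S = truncDiag r S' ∧ V = truncCols r V'

/-- The smallest nonzero singular value of the block diagonal matrix of a tensor in the transform
domain. -/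
def sigmaMin {a b c : ℕ} (A : Tensor a b c) : ℝ :=
  sInf {s : ℝ | 0 < s ∧ ∃ i : ℕ, (Matrix.toEuclideanLin (bdiag A)).singularValues i = s}

/-! ### Linearity of the product -/

theorem dct_add {a b c : ℕ} (A B : Tensor a b c) : dct (A + B) = dct A + dct B := by
  ext x; simp [dct, mul_add, Finset.sum_add_distrib]

theorem dct_smul {a b c : ℕ} (t : ℝ) (A : Tensor a b c) : dct (t • A) = t • dct A := by
  ext x; simp [dct, Finset.mul_sum, mul_left_comm]

theorem idct_add {a b c : ℕ} (A B : Tensor a b c) : idct (A + B) = idct A + idct B := by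
  ext x; simp [idct, mul_add, Finset.sum_add_distrib]

theorem idct_smul {a b c : ℕ} (t : ℝ) (A : Tensor a b c) : idct (t • A) = t • idct A := by
  ext x; simp [idct, Finset.mul_sum, mul_left_comm]

theorem bdiag_add {a b c : ℕ} (A B : Tensor a b c) : bdiag (A + B) = bdiag A + bdiag B := by
  rw [bdiag, dct_add, bdiag, bdiag, ← Matrix.blockDiagonal_add]; rfl

theorem bdiag_smul {a b c : ℕ} (t : ℝ) (A : Tensor a b c) : bdiag (t • A) = t • bdiag A := by
  rw [bdiag, dct_smul, bdiag, ← Matrix.blockDiagonal_smul]; rfl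

theorem fold_add {a b c : ℕ} (M N : Matrix (Fin a × Fin c) (Fin b × Fin c) ℝ) :
    fold (M + N) = fold M + fold N := rfl

theorem fold_smul {a b c : ℕ} (t : ℝ) (M : Matrix (Fin a × Fin c) (Fin b × Fin c) ℝ) :
    fold (t • M) = t • fold M := rfl

theorem tprod_add {a b d c : ℕ} (A : Tensor a b c) (B B' : Tensor b d c) :
    A ∗ₜ (B + B') = A ∗ₜ B + A ∗ₜ B' := by
  simp only [tprod, bdiag_add, Matrix.mul_add, fold_add, idct_add]

theorem add_tprod {a b d c : ℕ} (A A' : Tensor a b c) (B : Tensor b d c) :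
    (A + A') ∗ₜ B = A ∗ₜ B + A' ∗ₜ B := by
  simp only [tprod, bdiag_add, Matrix.add_mul, fold_add, idct_add]

theorem tprod_smul {a b d c : ℕ} (t : ℝ) (A : Tensor a b c) (B : Tensor b d c) :
    A ∗ₜ (t • B) = t • (A ∗ₜ B) := by
  simp only [tprod, bdiag_smul, Matrix.mul_smul, fold_smul, idct_smul]

theorem smul_tprod {a b d c : ℕ} (t : ℝ) (A : Tensor a b c) (B : Tensor b d c) :
    (t • A) ∗ₜ B = t • (A ∗ₜ B) := by
  simp only [tprod, bdiag_smul, Matrix.smul_mul, fold_smul, idct_smul]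

/-! ### Operators -/

/-- The orthogonal projection onto the tangent space
`{U ∗ₜ tr Z₁ + Z₂ ∗ₜ tr V}` of the fixed multi-rank manifold at `U ∗ₜ S ∗ₜ tr V`. The norm of such
a continuous linear map is the operator norm with respect to the Frobenius norm. -/
def tangentProj {a b d c : ℕ} (U : Tensor a d c) (V : Tensor b d c) :
    Tensor a b c →L[ℝ] Tensor a b c :=
  LinearMap.toContinuousLinearMap
    { toFun := fun A => U ∗ₜ tr U ∗ₜ A + A ∗ₜ V ∗ₜ tr V - U ∗ₜ tr U ∗ₜ A ∗ₜ V ∗ₜ tr V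
      map_add' := fun A B => by simp only [tprod_add, add_tprod]; abel
      map_smul' := fun t A => by
        simp only [tprod_smul, smul_tprod, RingHom.id_apply, smul_sub, smul_add] }

/-- The tensor with a single entry `1`. -/
def unitTensor {a b c : ℕ} (x : Fin a × Fin b × Fin c) : Tensor a b c :=
  EuclideanSpace.single x 1

/-- The sampling operator of a family of `m` indices, which may contain repetitions:
`Z ↦ ∑ₜ ⟨E_{Ω t}, Z⟩ E_{Ω t}`. -/
def samplingOp {a b c m : ℕ} (Ω : Fin m → Fin a × Fin b × Fin c) :
    Tensor a b c →L[ℝ] Tensor a b c :=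
  ∑ t, (innerSL ℝ (unitTensor (Ω t))).smulRight (unitTensor (Ω t))

/-! ### The algorithm -/

/-- The previous search direction, with the convention that the one before the first is zero. -/
def prevDir {E : Type*} [Zero E] (Q : ℕ → E) : ℕ → E
  | 0 => 0
  | l + 1 => Q l

/-- Both (non-)restarting conditions, for the projected residual `g` and the projected previous
search direction `q`. -/
def KeepsDirection {E : Type*} [NormedAddCommGroup E] [InnerProductSpace ℝ E]
    (k₁ k₂ : ℝ) (g q : E) : Prop :=
  |⟪g, q⟫_ℝ| / (‖g‖ * ‖q‖) ≤ k₁ ∧ ‖g‖ ≤ k₂ * ‖q‖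

/-- A run of the restarted tensor Riemannian conjugate gradient descent method for the completion of
`X` from the samples `Ω`, on the manifold of multi-rank `r`. Quotients `0 / 0` are read as `0`. -/
structure Run {a b c m : ℕ} (Ω : Fin m → Fin a × Fin b × Fin c) (X : Tensor a b c)
    (r : Fin c → ℕ) (k₁ k₂ : ℝ) where
  /-- the iterates -/
  iter : ℕ → Tensor a b c
  /-- the factors of the iterates -/
  U : ℕ → Tensor a (maxRank r) c
  S : ℕ → Tensor (maxRank r) (maxRank r) c
  V : ℕ → Tensor b (maxRank r) c
  /-- the residuals -/
  G : ℕ → Tensor a b c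
  /-- the search directions -/
  Q : ℕ → Tensor a b c
  /-- the points before truncation -/
  W : ℕ → Tensor a b c
  /-- the step sizes -/
  α : ℕ → ℝ
  /-- the orthogonalization weights -/
  β : ℕ → ℝ
  init : IsSkinnySVD r (iter 0) (U 0) (S 0) (V 0)
  G_eq : ∀ l, G l = samplingOp Ω (X - iter l)
  β_zero : β 0 = 0
  β_restart : ∀ l, ¬ KeepsDirection k₁ k₂ (tangentProj (U l) (V l) (G l))
    (tangentProj (U l) (V l) (prevDir Q l)) → β l = 0
  β_keep : ∀ l, l ≠ 0 → KeepsDirection k₁ k₂ (tangentProj (U l) (V l) (G l))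
    (tangentProj (U l) (V l) (prevDir Q l)) →
    β l = -(⟪tangentProj (U l) (V l) (G l),
          samplingOp Ω (tangentProj (U l) (V l) (prevDir Q l))⟫_ℝ /
        ⟪tangentProj (U l) (V l) (prevDir Q l),
          samplingOp Ω (tangentProj (U l) (V l) (prevDir Q l))⟫_ℝ)
  Q_eq : ∀ l, Q l = tangentProj (U l) (V l) (G l) +
    β l • tangentProj (U l) (V l) (prevDir Q l)
  α_eq : ∀ l, α l = ⟪tangentProj (U l) (V l) (G l), tangentProj (U l) (V l) (Q l)⟫_ℝ /
    ⟪tangentProj (U l) (V l) (Q l), samplingOp Ω (tangentProj (U l) (V l) (Q l))⟫_ℝ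
  W_eq : ∀ l, W l = iter l + α l • Q l
  trunc : ∀ l, IsTruncatedSVD r (W l) (U (l + 1)) (S (l + 1)) (V (l + 1))
  iter_succ : ∀ l, iter (l + 1) = U (l + 1) ∗ₜ S (l + 1) ∗ₜ tr (V (l + 1))

/-! ### The constants of the rate -/

def gamma₁ (k₁ k₂ ε : ℝ) : ℝ :=
  (18 * ε - 10 * k₁ * ε * (1 + 4 * ε)) / ((1 - 4 * ε) - k₁ * (1 + 4 * ε)) +
    (4 * k₂ * ε + k₁ * k₂) / (1 - 4 * ε)

def gamma₂ (k₁ k₂ ε : ℝ) : ℝ :=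
  (8 * k₂ * ε + 2 * k₁ * k₂) / (1 - 4 * ε)

def vcg (k₁ k₂ ε : ℝ) : ℝ :=
  (gamma₁ k₁ k₂ ε + Real.sqrt (gamma₁ k₁ k₂ ε ^ 2 + 4 * gamma₂ k₁ k₂ ε)) / 2

end TensorRCG

end

noncomputable section

open scoped InnerProductSpace

namespace TensorRCG

/-! Write e for the error of the current iterate, P and P₀ for the tangent projections at the
iterate and at the target, R for the sampling operator, L for the bound on ‖R‖ and t = ‖e‖ / σ_min.
On the tangent space the operator p⁻¹R is close to the identity, so a gradient step of length about
p⁻¹ nearly cancels the tangential error. What is left is the normal error, the wrong step length and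
the conjugate direction, and each of these is small.

Geometry: slicewise, the column and row projections of target and iterate differ by at most t. This
is a gap estimate for projections of equal rank (`IsOrthProj.norm_sub_apply_le_of_ker`,
`norm_proj_sub_le`). Hence ‖P - P₀‖ ≤ 2t and ‖e - P e‖ ≤ t‖e‖ (`norm_tangentProj_sub_le`,
`norm_error_sub_tangentProj_le`). The initial condition makes t so small compared with √p / L that
the isometry constant ε at the target becomes at most 4ε at the iterate (`IsOrthProj.rip_perturb`).

One step: the two restart conditions bound the weight of the old direction by κ = (4k₂ε + k₁k₂) / (1
- 4ε) and keep the new direction from being much shorter than the gradient. Conjugacy then puts the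
step length within a relative error η of p⁻¹ (`direction_estimates`, `stepsize_estimate`). Together
they bound the new error and the new direction linearly by the old ones (`step_estimates`).

Truncation is a best approximation (`eckart_young`), so it at most doubles the distance to the
target. This gives a 2 × 2 linear recursion for errors and scaled directions whose characteristic
equation is v² = γ₁v + γ₂, solved by v = `vcg`. If γ₁ + γ₂ < 1 then v < 1, the error never exceeds
its initial value, and the step estimates remain available (`coupled_recursion_le`). -/

/-! ### Operator estimates in an inner product space -/

section Abstract

variable {E : Type*} [NormedAddCommGroup E] [InnerProductSpace ℝ E]

/-- Symmetric idempotent operators. -/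
structure IsOrthProj (P : E →L[ℝ] E) : Prop where
  symm : ∀ x y, ⟪P x, y⟫_ℝ = ⟪x, P y⟫_ℝ
  idem : ∀ x, P (P x) = P x

/-- Symmetric positive semidefinite operators, with the Cauchy-Schwarz inequality of the associated
form. -/
structure IsPSD (R : E →L[ℝ] E) : Prop where
  symm : ∀ x y, ⟪R x, y⟫_ℝ = ⟪x, R y⟫_ℝ
  nonneg : ∀ x, 0 ≤ ⟪x, R x⟫_ℝ
  cauchy_schwarz : ∀ x y, ⟪x, R y⟫_ℝ ^ 2 ≤ ⟪x, R x⟫_ℝ * ⟪y, R y⟫_ℝ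

theorem IsOrthProj.norm_apply_le {P : E →L[ℝ] E} (hP : IsOrthProj P) (x : E) : ‖P x‖ ≤ ‖x‖ := by
  have h : ‖P x‖ * ‖P x‖ ≤ ‖P x‖ * ‖x‖ := by
    rw [← real_inner_self_eq_norm_mul_norm, hP.symm, hP.idem, real_inner_comm]
    exact real_inner_le_norm _ _
  rcases (norm_nonneg (P x)).eq_or_lt with h0 | h0
  · rw [← h0]; exact norm_nonneg _
  · exact le_of_mul_le_mul_left h h0

/-- Cauchy-Schwarz for the form of `R`, applied to `R y` and `y`, trades one factor `L` for the form
itself. On a space where the form is about p‖y‖² this bounds `R` by about √(Lp) instead of `L`. -/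
theorem IsPSD.norm_sq_le {R : E →L[ℝ] E} (hR : IsPSD R) {L : ℝ} (hL : ‖R‖ ≤ L) (y : E) :
    ‖R y‖ ^ 2 ≤ L * ⟪y, R y⟫_ℝ := by
  have h := hR.cauchy_schwarz (R y) y
  rw [real_inner_self_eq_norm_sq] at h
  rcases (norm_nonneg (R y)).eq_or_lt with h0 | h0
  · have : R y = 0 := norm_eq_zero.1 h0.symm
    simp [this]
  have h1 : ⟪R y, R (R y)⟫_ℝ ≤ L * ‖R y‖ ^ 2 := by
    calc _ ≤ ‖R y‖ * ‖R (R y)‖ := real_inner_le_norm _ _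
      _ ≤ ‖R y‖ * (L * ‖R y‖) := by gcongr; exact R.le_of_opNorm_le hL _
      _ = _ := by ring
  have h3 : (‖R y‖ ^ 2) * (‖R y‖ ^ 2) ≤ (‖R y‖ ^ 2) * (L * ⟪y, R y⟫_ℝ) := by
    nlinarith [mul_le_mul_of_nonneg_right h1 (hR.nonneg y)]
  exact le_of_mul_le_mul_left h3 (by positivity)

/-- The restricted isometry property in bilinear form. -/
theorem IsOrthProj.abs_inner_sub_le {P R : E →L[ℝ] E} (hP : IsOrthProj P) {p ε : ℝ}
    (h : ∀ z, ‖P z - p⁻¹ • P (R (P z))‖ ≤ ε * ‖z‖) {x y : E} (hx : P x = x) (hy : P y = y) :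
    |⟪x, y⟫_ℝ - p⁻¹ * ⟪x, R y⟫_ℝ| ≤ ε * ‖x‖ * ‖y‖ := by
  have e : ⟪x, y⟫_ℝ - p⁻¹ * ⟪x, R y⟫_ℝ = ⟪x, P y - p⁻¹ • P (R (P y))⟫_ℝ := by
    rw [inner_sub_right, inner_smul_right, ← hP.symm, ← hP.symm, hx, hy]
  rw [e]
  calc _ ≤ ‖x‖ * ‖P y - p⁻¹ • P (R (P y))‖ := abs_real_inner_le_norm _ _
    _ ≤ ‖x‖ * (ε * ‖y‖) := by gcongr; exact h y
    _ = _ := by ring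

theorem IsOrthProj.inner_apply_mem_Icc {P R : E →L[ℝ] E} (hP : IsOrthProj P) {p ε : ℝ} (hp : 0 < p)
    (h : ∀ z, ‖P z - p⁻¹ • P (R (P z))‖ ≤ ε * ‖z‖) {x : E} (hx : P x = x) :
    ⟪x, R x⟫_ℝ ∈ Set.Icc ((1 - ε) * p * ‖x‖ ^ 2) ((1 + ε) * p * ‖x‖ ^ 2) := by
  have h1 := hP.abs_inner_sub_le h hx hx
  rw [real_inner_self_eq_norm_sq, abs_le] at h1
  have e : ⟪x, R x⟫_ℝ = p * (p⁻¹ * ⟪x, R x⟫_ℝ) := by field_simp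
  rw [e]
  constructor <;> nlinarith

/-- The sampling operator on the range of a projection with the restricted isometry property. -/
theorem IsOrthProj.norm_sampling_le {P R : E →L[ℝ] E} (hP : IsOrthProj P) (hR : IsPSD R)
    {p ε L N : ℝ} (hp : 0 < p) (hε : 0 < ε) (hL : ‖R‖ ≤ L) (hN : 0 ≤ N)
    (hN2 : L * (1 + ε) * p = N ^ 2)
    (h : ∀ z, ‖P z - p⁻¹ • P (R (P z))‖ ≤ ε * ‖z‖) (z : E) :
    ‖R (P z)‖ ≤ N * ‖z‖ := by
  have hL0 : 0 ≤ L := (norm_nonneg _).trans hL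
  refine le_of_sq_le_sq ?_ (by positivity)
  calc ‖R (P z)‖ ^ 2 ≤ L * ⟪P z, R (P z)⟫_ℝ := hR.norm_sq_le hL _
    _ ≤ L * ((1 + ε) * p * ‖z‖ ^ 2) := by
      gcongr
      refine (hP.inner_apply_mem_Icc hp h (hP.idem z)).2.trans ?_
      gcongr
      exact hP.norm_apply_le z
    _ = (N * ‖z‖) ^ 2 := by rw [mul_pow, ← hN2]; ring

/-- Passing to the adjoint of `R ∘ P`. -/
theorem IsOrthProj.norm_apply_sampling_le {P R : E →L[ℝ] E} (hP : IsOrthProj P) (hR : IsPSD R)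
    {N : ℝ} (hN : 0 ≤ N) (h : ∀ z, ‖R (P z)‖ ≤ N * ‖z‖) (z : E) : ‖P (R z)‖ ≤ N * ‖z‖ := by
  rcases (norm_nonneg (P (R z))).eq_or_lt with h0 | h0
  · rw [← h0]; positivity
  refine le_of_mul_le_mul_left ?_ h0
  calc ‖P (R z)‖ * ‖P (R z)‖ = ⟪R (P (R z)), z⟫_ℝ := by
        rw [← real_inner_self_eq_norm_mul_norm, hP.symm, hP.idem, hR.symm, real_inner_comm]
    _ ≤ ‖R (P (R z))‖ * ‖z‖ := real_inner_le_norm _ _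
    _ = ‖R (P (P (R z)))‖ * ‖z‖ := by rw [hP.idem]
    _ ≤ N * ‖P (R z)‖ * ‖z‖ := by gcongr; exact h _
    _ = _ := by ring

/-- The error budget. Here `q` is the square root of the sampling rate, `D` bounds the distance of
the two tangent projections and `D / 2` the relative normal error. Everything reduces to D ≤ ε/s,
(ε/s)(D/q) ≤ ε²/s², w(D/q) ≤ ε/w ≤ ε and ε/s + ε²/s² ≤ ε. The first bound is the loss in the
isometry constant, the second the total effect of the normal error. -/
theorem perturbation_constant_le {q w ε s L D : ℝ} (hq : 0 < q) (hw : 0 < w) (hε : 0 < ε)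
    (hs : s = 1 + ε) (hws : w ^ 2 = L * s) (hL : 1 ≤ L) (hqL : q ^ 2 ≤ L)
    (hD : D ≤ q * ε / (L * s)) (hD0 : 0 ≤ D) :
    D + (q ^ 2)⁻¹ * (q * (ε / s + w) + w * q) * D ≤ 3 * ε ∧
      D / 2 + (q ^ 2)⁻¹ * (q * (ε / s + w)) * (D / 2) ≤ ε := by
  have hs1 : 1 < s := by linarith
  have hw1 : 1 ≤ w := by
    by_contra hlt
    push Not at hlt
    nlinarith
  have hq1 : q ≤ L := by
    by_contra hlt
    push Not at hlt
    nlinarith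
  have hD' : D / q ≤ ε / w ^ 2 := by
    rw [div_le_iff₀ hq, hws]
    refine hD.trans (le_of_eq ?_)
    ring
  have h1 : D ≤ ε / s := by
    refine hD.trans ?_
    rw [div_le_div_iff₀ (by positivity) (by positivity)]
    have : 0 ≤ ε * s := by positivity
    nlinarith
  have hDq : 0 ≤ D / q := by positivity
  have h2 : (q ^ 2)⁻¹ * (q * (ε / s + w)) * D = (ε / s + w) * (D / q) := by
    field_simp
  have h3 : (ε / s) * (D / q) ≤ ε ^ 2 / s ^ 2 := by
    have : D / q ≤ ε / s := by
      refine hD'.trans ?_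
      gcongr
      nlinarith
    calc _ ≤ (ε / s) * (ε / s) := by gcongr
      _ = _ := by ring
  have h4 : w * (D / q) ≤ ε := by
    calc w * (D / q) ≤ w * (ε / w ^ 2) := by gcongr
      _ = ε / w := by field_simp
      _ ≤ ε := div_le_self hε.le hw1
  have h5 : ε / s + ε ^ 2 / s ^ 2 ≤ ε := by
    rw [div_add_div _ _ (by positivity) (by positivity), div_le_iff₀ (by positivity), hs]
    have : 0 ≤ ε ^ 3 * (1 + ε) := by positivity
    nlinarith
  have h6 : (q ^ 2)⁻¹ * (q * (ε / s + w) + w * q) * D =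
      (ε / s) * (D / q) + 2 * (w * (D / q)) := by
    field_simp; ring
  have h7 : (q ^ 2)⁻¹ * (q * (ε / s + w)) * (D / 2) =
      ((ε / s) * (D / q) + w * (D / q)) / 2 := by
    field_simp
  rw [h6, h7]
  constructor <;> linarith

/-- Perturbation of the restricted isometry property. Here `q ^ 2` is the sampling rate. -/
theorem IsOrthProj.rip_perturb {P₀ P R : E →L[ℝ] E} (hP₀ : IsOrthProj P₀) (hP : IsOrthProj P)
    (hR : IsPSD R) {q w ε s L D : ℝ} (hq : 0 < q) (hw : 0 < w) (hε : 0 < ε)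
    (hs : s = 1 + ε) (hws : w ^ 2 = L * s) (hL : 1 ≤ L) (hqL : q ^ 2 ≤ L)
    (hD : D ≤ q * ε / (L * s)) (hRL : ‖R‖ ≤ L)
    (hPP : ∀ z, ‖P z - P₀ z‖ ≤ D * ‖z‖) (hD0 : 0 ≤ D)
    (h : ∀ z, ‖P₀ z - (q ^ 2)⁻¹ • P₀ (R (P₀ z))‖ ≤ ε * ‖z‖) :
    (∀ z, ‖P (R z)‖ ≤ q * (ε / s + w) * ‖z‖) ∧
      (∀ z, ‖P z - (q ^ 2)⁻¹ • P (R (P z))‖ ≤ 4 * ε * ‖z‖) := by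
  have hs0 : 0 < s := by linarith
  have hN2 : L * (1 + ε) * q ^ 2 = (w * q) ^ 2 := by rw [mul_pow, hws, hs]
  have hN := hP₀.norm_sampling_le hR (by positivity) hε hRL (by positivity) hN2 h
  have hN' := hP₀.norm_apply_sampling_le hR (by positivity) hN
  have hM : ∀ z, ‖R (P z)‖ ≤ q * (ε / s + w) * ‖z‖ := by
    intro z
    have e : R (P z) = R (P z - P₀ z) + R (P₀ z) := by rw [← map_add, sub_add_cancel]
    rw [e]
    have h1 : ‖R (P z - P₀ z)‖ ≤ q * (ε / s) * ‖z‖ := by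
      calc _ ≤ L * ‖P z - P₀ z‖ := R.le_of_opNorm_le hRL _
        _ ≤ L * (q * ε / (L * s) * ‖z‖) := by
          gcongr
          exact (hPP z).trans (by gcongr)
        _ = _ := by field_simp
    calc _ ≤ _ := norm_add_le _ _
      _ ≤ q * (ε / s) * ‖z‖ + w * q * ‖z‖ := add_le_add h1 (hN z)
      _ = _ := by ring
  refine ⟨hP.norm_apply_sampling_le hR (by positivity) hM, fun z => ?_⟩
  -- `P₀` is exchanged for `P` one factor at a time: the defect of `P₀` costs ε, the three
  -- differences together 3ε.
  have e : P z - (q ^ 2)⁻¹ • P (R (P z)) = (P z - P₀ z) + (P₀ z - (q ^ 2)⁻¹ • P₀ (R (P₀ z)))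
      - (q ^ 2)⁻¹ • (P₀ (R (P z - P₀ z)) + (P (R (P z)) - P₀ (R (P z)))) := by
    simp only [map_sub, smul_add, smul_sub]; abel
  have hc := (perturbation_constant_le hq hw hε hs hws hL hqL hD hD0).1
  rw [e]
  calc _ ≤ ‖P z - P₀ z‖ + ‖P₀ z - (q ^ 2)⁻¹ • P₀ (R (P₀ z))‖ + (q ^ 2)⁻¹ *
        (‖P₀ (R (P z - P₀ z))‖ + ‖P (R (P z)) - P₀ (R (P z))‖) := by
        refine (norm_sub_le _ _).trans (add_le_add (norm_add_le _ _) ?_)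
        rw [norm_smul, Real.norm_of_nonneg (by positivity)]
        gcongr
        exact norm_add_le _ _
    _ ≤ D * ‖z‖ + ε * ‖z‖ + (q ^ 2)⁻¹ * (w * q * (D * ‖z‖) + D * (q * (ε / s + w) * ‖z‖)) := by
        gcongr
        · exact hPP z
        · exact h z
        · exact (hN' _).trans (by gcongr; exact hPP z)
        · exact (hPP _).trans (by gcongr; exact hM z)
    _ = (D + (q ^ 2)⁻¹ * (q * (ε / s + w) + w * q) * D + ε) * ‖z‖ := by ring
    _ ≤ (3 * ε + ε) * ‖z‖ := by gcongr
    _ = _ := by ring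

/-! ### One step of the conjugate gradient method -/

/-- The first condition for keeping the direction, without the quotient. -/
theorem KeepsDirection.abs_inner_le {k₁ k₂ : ℝ} {g q : E} (h : KeepsDirection k₁ k₂ g q) :
    |⟪g, q⟫_ℝ| ≤ k₁ * (‖g‖ * ‖q‖) := by
  have h1 := h.1
  rcases (by positivity : 0 ≤ ‖g‖ * ‖q‖).eq_or_lt with h0 | h0
  · have := abs_real_inner_le_norm g q
    rw [← h0] at this ⊢
    linarith
  · rwa [div_le_iff₀ h0] at h1

/-- The weight of the previous direction, and the new direction. -/
theorem direction_estimates {P R : E →L[ℝ] E} (hP : IsOrthProj P) {p ε k₁ k₂ b : ℝ} (hp : 0 < p)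
    (hε : 0 < ε) (hε1 : 4 * ε < 1) (hk₁ : 0 ≤ k₁) (hk₁' : k₁ < 1) (hk₂ : 0 ≤ k₂)
    (h : ∀ z, ‖P z - p⁻¹ • P (R (P z))‖ ≤ 4 * ε * ‖z‖) {g q : E} (hg : P g = g) (hq : P q = q)
    (hb : b = 0 ∨ KeepsDirection k₁ k₂ g q ∧ b = -(⟪g, R q⟫_ℝ / ⟪q, R q⟫_ℝ)) :
    |b| ≤ (4 * k₂ * ε + k₁ * k₂) / (1 - 4 * ε) ∧ (1 - k₁) * ‖g‖ ≤ ‖g + b • q‖ ∧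
      ⟪g + b • q, R (g + b • q)⟫_ℝ = ⟪g + b • q, R g⟫_ℝ := by
  have h4 : 0 < 1 - 4 * ε := by linarith
  rcases hb with rfl | ⟨hk, hb⟩
  · refine ⟨by rw [abs_zero]; positivity, ?_, by simp⟩
    rw [zero_smul, add_zero]
    nlinarith [norm_nonneg g]
  have hgq := hk.abs_inner_le
  refine ⟨?_, ?_, ?_⟩
  · rcases eq_or_ne q 0 with rfl | hq0
    · simp only [map_zero, inner_zero_right, div_zero, neg_zero] at hb
      rw [hb, abs_zero]; positivity
    have hqn : 0 < ‖q‖ := norm_pos_iff.2 hq0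
    have hden := (hP.inner_apply_mem_Icc hp h hq).1
    have hden0 : 0 < (1 - 4 * ε) * p * ‖q‖ ^ 2 := by positivity
    have hnum : |⟪g, R q⟫_ℝ| ≤ p * ((4 * k₂ * ε + k₁ * k₂) * ‖q‖ ^ 2) := by
      have h1 := hP.abs_inner_sub_le h hg hq
      have e : ⟪g, R q⟫_ℝ = p * (p⁻¹ * ⟪g, R q⟫_ℝ) := by field_simp
      rw [e, abs_mul, abs_of_pos hp]
      gcongr
      have h2 : |p⁻¹ * ⟪g, R q⟫_ℝ| ≤ (4 * ε + k₁) * (‖g‖ * ‖q‖) := by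
        rw [abs_le] at *
        constructor <;> nlinarith
      refine h2.trans ?_
      calc (4 * ε + k₁) * (‖g‖ * ‖q‖) ≤ (4 * ε + k₁) * (k₂ * ‖q‖ * ‖q‖) := by
            gcongr; exact hk.2
        _ = _ := by ring
    rw [hb, abs_neg, abs_div, abs_of_pos (hden0.trans_le hden), div_le_div_iff₀
      (hden0.trans_le hden) h4]
    calc _ ≤ p * ((4 * k₂ * ε + k₁ * k₂) * ‖q‖ ^ 2) * (1 - 4 * ε) := by gcongr
      _ = (4 * k₂ * ε + k₁ * k₂) * ((1 - 4 * ε) * p * ‖q‖ ^ 2) := by ring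
      _ ≤ _ := by gcongr
  · refine le_of_sq_le_sq ?_ (norm_nonneg _)
    rw [norm_add_sq_real, inner_smul_right, norm_smul, Real.norm_eq_abs]
    -- Completing the square in |b|‖q‖ leaves (1 - k₁²)‖g‖², which is at least (1 - k₁)²‖g‖² because
    -- 0 ≤ k₁ < 1.
    have h1 : -(|b| * (k₁ * (‖g‖ * ‖q‖))) ≤ b * ⟪g, q⟫_ℝ := by
      have : |b * ⟪g, q⟫_ℝ| ≤ |b| * (k₁ * (‖g‖ * ‖q‖)) := by
        rw [abs_mul]; gcongr
      exact (abs_le.1 this).1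
    have h2 : 0 ≤ k₁ * (1 - k₁) * ‖g‖ ^ 2 := by
      have : 0 ≤ 1 - k₁ := by linarith
      positivity
    nlinarith [sq_nonneg (k₁ * ‖g‖ - |b| * ‖q‖)]
  -- The weight makes the new direction `R`-orthogonal to `q`; if the form vanishes at `q`, the
  -- quotient is 0 by convention and so is `b`.
  · have hz : b * ⟪g + b • q, R q⟫_ℝ = 0 := by
      rw [inner_add_left, real_inner_smul_left]
      by_cases h0 : ⟪q, R q⟫_ℝ = 0
      · rw [h0, div_zero, neg_zero] at hb
        rw [hb, zero_mul]
      · rw [hb]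
        field_simp
        ring
    rw [map_add, map_smul, inner_add_right, inner_smul_right, hz, add_zero]

/-- The relative deviation of the step size from the inverse sampling rate. -/
theorem stepsize_estimate {P R : E →L[ℝ] E} (hP : IsOrthProj P) {p ε k₁ : ℝ} (hp : 0 < p)
    (hε : 0 < ε) (hk₁ : 0 ≤ k₁) (hD : 0 < (1 - 4 * ε) - k₁ * (1 + 4 * ε)) (hε1 : 4 * ε < 1)
    (h : ∀ z, ‖P z - p⁻¹ • P (R (P z))‖ ≤ 4 * ε * ‖z‖) {g Q : E} (hg : P g = g) (hQ : P Q = Q)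
    (hgQ : (1 - k₁) * ‖g‖ ≤ ‖Q‖) (hconj : ⟪Q, R Q⟫_ℝ = ⟪Q, R g⟫_ℝ) (hQ0 : Q ≠ 0) :
    |⟪g, Q⟫_ℝ / ⟪Q, R Q⟫_ℝ * p - 1| ≤ 4 * ε / ((1 - 4 * ε) - k₁ * (1 + 4 * ε)) := by
  have hQn : 0 < ‖Q‖ := norm_pos_iff.2 hQ0
  have h4 : 0 < 1 - 4 * ε := by linarith
  have hden := (hP.inner_apply_mem_Icc hp h hQ).1
  have hden0 : 0 < (1 - 4 * ε) * p * ‖Q‖ ^ 2 := by positivity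
  have hpos := hden0.trans_le hden
  -- By conjugacy the denominator equals ⟪Q, R g⟫, which the bilinear isometry bound compares with
  -- the numerator ⟪g, Q⟫.
  have h1 := hP.abs_inner_sub_le h hQ hg
  rw [← hconj, real_inner_comm] at h1
  have e : ⟪g, Q⟫_ℝ / ⟪Q, R Q⟫_ℝ * p - 1 =
      p * (⟪g, Q⟫_ℝ - p⁻¹ * ⟪Q, R Q⟫_ℝ) / ⟪Q, R Q⟫_ℝ := by
    field_simp
  rw [e, abs_div, abs_mul, abs_of_pos hp, abs_of_pos hpos, div_le_div_iff₀ hpos hD]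
  set D := (1 - 4 * ε) - k₁ * (1 + 4 * ε) with hDdef
  -- The two sides differ by 8k₁ε, so the bound with `D` is slightly weaker than what the argument
  -- gives.
  have hDle : D ≤ (1 - 4 * ε) * (1 - k₁) := by nlinarith
  calc _ ≤ p * (4 * ε * ‖Q‖ * ‖g‖) * ((1 - 4 * ε) * (1 - k₁)) := by gcongr
    _ = 4 * ε * p * ‖Q‖ * (1 - 4 * ε) * ((1 - k₁) * ‖g‖) := by ring
    _ ≤ 4 * ε * p * ‖Q‖ * (1 - 4 * ε) * ‖Q‖ := by gcongr
    _ = 4 * ε * ((1 - 4 * ε) * p * ‖Q‖ ^ 2) := by ring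
    _ ≤ _ := by gcongr

/-- One step of the method: `e` is the error, `q` the previous direction, `τ` the relative error. -/
theorem step_estimates {P R : E →L[ℝ] E} (hP : IsOrthProj P) {p ε k₁ k₂ b a τ M : ℝ} (hp : 0 < p)
    (hε : 0 < ε) (hk₁ : 0 ≤ k₁) (hk₂ : 0 ≤ k₂) (hD : 0 < (1 - 4 * ε) - k₁ * (1 + 4 * ε))
    (h : ∀ z, ‖P z - p⁻¹ • P (R (P z))‖ ≤ 4 * ε * ‖z‖) (hM : ∀ z, ‖P (R z)‖ ≤ M * ‖z‖)
    (hM0 : 0 ≤ M) (hτ0 : 0 ≤ τ) (hτ : τ + p⁻¹ * M * τ ≤ ε) {e q Q : E}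
    (he : ‖e - P e‖ ≤ τ * ‖e‖)
    (hb : b = 0 ∨ KeepsDirection k₁ k₂ (P (R (-e))) (P q) ∧
      b = -(⟪P (R (-e)), R (P q)⟫_ℝ / ⟪P q, R (P q)⟫_ℝ))
    (hQ : Q = P (R (-e)) + b • P q)
    (ha : a = ⟪P (R (-e)), P Q⟫_ℝ / ⟪P Q, R (P Q)⟫_ℝ) :
    ‖e + a • Q‖ ≤
        (9 * ε - 5 * k₁ * ε * (1 + 4 * ε)) / ((1 - 4 * ε) - k₁ * (1 + 4 * ε)) * ‖e‖ +
        (4 * k₂ * ε + k₁ * k₂) / (1 - 4 * ε) *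
          (p⁻¹ * (1 + 4 * ε / ((1 - 4 * ε) - k₁ * (1 + 4 * ε))) * ‖q‖) ∧
      p⁻¹ * (1 + 4 * ε / ((1 - 4 * ε) - k₁ * (1 + 4 * ε))) * ‖Q‖ ≤
        (1 + (9 * ε - 5 * k₁ * ε * (1 + 4 * ε)) / ((1 - 4 * ε) - k₁ * (1 + 4 * ε))) * ‖e‖ +
        (4 * k₂ * ε + k₁ * k₂) / (1 - 4 * ε) *
          (p⁻¹ * (1 + 4 * ε / ((1 - 4 * ε) - k₁ * (1 + 4 * ε))) * ‖q‖) := by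
  have hkε : 0 ≤ k₁ * (1 + 4 * ε) := by positivity
  have hε1 : 4 * ε < 1 := by linarith
  have hk₁' : k₁ < 1 := by nlinarith
  set g := P (R (-e)) with hgdef
  have hg : P g = g := hP.idem _
  have hq : P (P q) = P q := hP.idem _
  have hPQ : P Q = Q := by rw [hQ, map_add, map_smul, hg, hq]
  obtain ⟨hbκ, hgQ, hconj⟩ := direction_estimates hP hp hε hε1 hk₁ hk₁' hk₂ h hg hq hb
  rw [← hQ] at hgQ hconj
  rw [hPQ] at ha
  set D := (1 - 4 * ε) - k₁ * (1 + 4 * ε) with hDdef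
  set κ := (4 * k₂ * ε + k₁ * k₂) / (1 - 4 * ε) with hκ
  set η := 4 * ε / D with hη
  have hη0 : 0 ≤ η := by positivity
  -- The contraction constant split by origin: isometry defect, wrong step length, and normal error.
  have hA : (9 * ε - 5 * k₁ * ε * (1 + 4 * ε)) / D =
      4 * ε + (1 + 4 * ε) * η + ε * (1 + η) := by
    rw [hη]; field_simp; rw [hDdef]; ring
  rw [hA]
  -- For `Q = 0` the step length has no effect, and the ideal value `p⁻¹` may replace it.
  obtain ⟨a', haQ, ha'⟩ : ∃ a', a • Q = a' • Q ∧ |a' * p - 1| ≤ η := by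
    by_cases hQ0 : Q = 0
    · exact ⟨p⁻¹, by simp [hQ0], by rw [inv_mul_cancel₀ hp.ne']; simpa using hη0⟩
    · exact ⟨a, rfl, by
        rw [ha]; exact stepsize_estimate hP hp hε hk₁ hD hε1 h hg hPQ hgQ hconj hQ0⟩
  have ha'p : |a'| ≤ p⁻¹ * (1 + η) := by
    have h1 : |a' * p| ≤ 1 + η := by
      rw [abs_le] at *
      constructor <;> linarith
    rw [abs_mul, abs_of_pos hp] at h1
    rw [inv_mul_eq_div, le_div_iff₀ hp]
    exact h1
  have hR1 : ‖P (R (P e))‖ ≤ p * ((1 + 4 * ε) * ‖e‖) := by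
    have h1 : ‖p⁻¹ • P (R (P e))‖ ≤ (1 + 4 * ε) * ‖e‖ := by
      calc _ = ‖P e - (P e - p⁻¹ • P (R (P e)))‖ := by rw [sub_sub_cancel]
        _ ≤ ‖P e‖ + ‖P e - p⁻¹ • P (R (P e))‖ := norm_sub_le _ _
        _ ≤ ‖e‖ + 4 * ε * ‖e‖ := add_le_add (hP.norm_apply_le e) (h e)
        _ = _ := by ring
    rw [norm_smul, Real.norm_of_nonneg (by positivity), inv_mul_le_iff₀ hp] at h1
    exact h1
  have hR2 : ‖P (R (e - P e))‖ ≤ M * (τ * ‖e‖) := (hM _).trans (by gcongr)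
  have hge : g = -(P (R (P e)) + P (R (e - P e))) := by
    rw [hgdef, ← map_add, ← map_add, add_sub_cancel, map_neg, map_neg]
  have hgn : p⁻¹ * ‖g‖ ≤ (1 + 4 * ε + p⁻¹ * M * τ) * ‖e‖ := by
    rw [hge, norm_neg]
    calc _ ≤ p⁻¹ * (p * ((1 + 4 * ε) * ‖e‖) + M * (τ * ‖e‖)) := by
          gcongr
          exact (norm_add_le _ _).trans (add_le_add hR1 hR2)
      _ = _ := by field_simp
  have hMτ : 0 ≤ p⁻¹ * M * τ := by positivity
  have hqn : |b| * ‖P q‖ ≤ κ * ‖q‖ := by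
    gcongr
    exact hP.norm_apply_le q
  constructor
  -- Normal error, defect of the ideal step, deviation of the step length, normal error seen through
  -- sampling, and old direction.
  · have ee : e + a • Q = (e - P e) + (P e - p⁻¹ • P (R (P e))) +
        ((1 - a' * p) * p⁻¹) • P (R (P e)) - a' • P (R (e - P e)) + a' • (b • P q) := by
      rw [haQ, hQ, hge, sub_mul, one_mul, mul_assoc, mul_inv_cancel₀ hp.ne', mul_one]
      module
    rw [ee]
    have t1 : ‖((1 - a' * p) * p⁻¹) • P (R (P e))‖ ≤ η * ((1 + 4 * ε) * ‖e‖) := by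
      rw [norm_smul, Real.norm_eq_abs, abs_mul, abs_sub_comm, abs_of_pos (inv_pos.2 hp)]
      calc _ ≤ η * p⁻¹ * (p * ((1 + 4 * ε) * ‖e‖)) := by gcongr
        _ = _ := by field_simp
    have t2 : ‖a' • P (R (e - P e))‖ ≤ p⁻¹ * (1 + η) * (M * (τ * ‖e‖)) := by
      rw [norm_smul, Real.norm_eq_abs]; gcongr
    have t3 : ‖a' • (b • P q)‖ ≤ p⁻¹ * (1 + η) * (κ * ‖q‖) := by
      rw [norm_smul, norm_smul, Real.norm_eq_abs, Real.norm_eq_abs]; gcongr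
    calc _ ≤ τ * ‖e‖ + 4 * ε * ‖e‖ + η * ((1 + 4 * ε) * ‖e‖) +
          p⁻¹ * (1 + η) * (M * (τ * ‖e‖)) + p⁻¹ * (1 + η) * (κ * ‖q‖) := by
          refine (norm_add_le _ _).trans (add_le_add ?_ t3)
          refine (norm_sub_le _ _).trans (add_le_add ?_ t2)
          refine (norm_add_le _ _).trans (add_le_add ?_ t1)
          exact (norm_add_le _ _).trans (add_le_add he (h e))
      _ = (4 * ε + (1 + 4 * ε) * η + (τ + (1 + η) * (p⁻¹ * M * τ))) * ‖e‖ +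
          κ * (p⁻¹ * (1 + η) * ‖q‖) := by ring
      _ ≤ _ := by
          gcongr
          nlinarith
  · calc p⁻¹ * (1 + η) * ‖Q‖ ≤ p⁻¹ * (1 + η) * (‖g‖ + κ * ‖q‖) := by
          gcongr
          rw [hQ]
          refine (norm_add_le _ _).trans (add_le_add le_rfl ?_)
          rw [norm_smul, Real.norm_eq_abs]
          exact hqn
      _ = (1 + η) * (p⁻¹ * ‖g‖) + κ * (p⁻¹ * (1 + η) * ‖q‖) := by ring
      _ ≤ (1 + η) * ((1 + 4 * ε + p⁻¹ * M * τ) * ‖e‖) + κ * (p⁻¹ * (1 + η) * ‖q‖) := by gcongr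
      _ ≤ (1 + η) * ((1 + 4 * ε + ε) * ‖e‖) + κ * (p⁻¹ * (1 + η) * ‖q‖) := by
          gcongr
          linarith
      _ = _ := by ring

end Abstract

/-! ### The gap between projections of equal rank -/

section Gap

variable {E : Type*} [NormedAddCommGroup E] [InnerProductSpace ℝ E]

theorem IsOrthProj.norm_sub_sq {P : E →L[ℝ] E} (hP : IsOrthProj P) (x : E) :
    ‖x - P x‖ ^ 2 = ‖x‖ ^ 2 - ‖P x‖ ^ 2 := by
  have h : ⟪x, P x⟫_ℝ = ‖P x‖ ^ 2 := by
    rw [← real_inner_self_eq_norm_sq, hP.symm, hP.idem]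
  rw [norm_sub_sq_real, h]
  ring

theorem IsOrthProj.norm_sub_apply_le {P : E →L[ℝ] E} (hP : IsOrthProj P) (x : E) :
    ‖x - P x‖ ≤ ‖x‖ := by
  refine le_of_sq_le_sq ?_ (norm_nonneg _)
  rw [hP.norm_sub_sq]
  linarith [sq_nonneg ‖P x‖]

/-- If `P` is small on the kernel of `Q`, then `1 - Q` is small on the range of `P`. -/
theorem IsOrthProj.norm_sub_le_of_ker {P Q : E →L[ℝ] E} (hP : IsOrthProj P) (hQ : IsOrthProj Q)
    {c : ℝ} (hc : 0 ≤ c) (h : ∀ x, Q x = 0 → ‖P x‖ ≤ c * ‖x‖) {x : E} (hx : P x = x) :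
    ‖x - Q x‖ ≤ c * ‖x‖ := by
  have hk : Q (x - Q x) = 0 := by rw [map_sub, hQ.idem, sub_self]
  have h1 := h _ hk
  have h2 : ‖x - Q x‖ ^ 2 = ⟪x, P (x - Q x)⟫_ℝ := by
    have h3 : ⟪Q x, x - Q x⟫_ℝ = 0 := by rw [hQ.symm, hk, inner_zero_right]
    rw [← hP.symm, hx, ← real_inner_self_eq_norm_sq]
    conv_lhs => rw [inner_sub_left, h3, sub_zero]
  rcases (norm_nonneg (x - Q x)).eq_or_lt with h0 | h0
  · rw [← h0]; positivity
  · refine le_of_mul_le_mul_left ?_ h0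
    calc ‖x - Q x‖ * ‖x - Q x‖ = ⟪x, P (x - Q x)⟫_ℝ := by rw [← h2]; ring
      _ ≤ ‖x‖ * ‖P (x - Q x)‖ := real_inner_le_norm _ _
      _ ≤ ‖x‖ * (c * ‖x - Q x‖) := by gcongr
      _ = _ := by ring

/-- For projections of equal rank the roles of `P` and `Q` can be exchanged. -/
theorem IsOrthProj.norm_sub_le_symm [FiniteDimensional ℝ E] {P Q : E →L[ℝ] E} (hP : IsOrthProj P)
    (hQ : IsOrthProj Q)
    (hr : Module.finrank ℝ (LinearMap.range (P : E →ₗ[ℝ] E)) =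
      Module.finrank ℝ (LinearMap.range (Q : E →ₗ[ℝ] E)))
    {c : ℝ} (hc : 0 ≤ c) (h : ∀ x, P x = x → ‖x - Q x‖ ≤ c * ‖x‖) {y : E} (hy : Q y = y) :
    ‖y - P y‖ ≤ c * ‖y‖ := by
  rcases le_or_gt 1 c with hc1 | hc1
  · exact (hP.norm_sub_apply_le y).trans (le_mul_of_one_le_left (norm_nonneg _) hc1)
  have hPr : ∀ x ∈ LinearMap.range (P : E →ₗ[ℝ] E), P x = x := by
    rintro _ ⟨x, rfl⟩
    exact hP.idem x
  let f : LinearMap.range (P : E →ₗ[ℝ] E) →ₗ[ℝ] LinearMap.range (Q : E →ₗ[ℝ] E) :=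
    (Q : E →ₗ[ℝ] E).rangeRestrict ∘ₗ (LinearMap.range (P : E →ₗ[ℝ] E)).subtype
  have hf : ∀ x, (f x : E) = Q x := fun _ => rfl
  -- Since c < 1, `Q` kills no nonzero vector of the range of `P`; equality of ranks then makes
  -- every `y` in the range of `Q` an image `Q x` with `P x = x`.
  have hinj : Function.Injective f := by
    rw [injective_iff_map_eq_zero]
    intro x hx
    have h0 : Q x = 0 := by rw [← hf, hx]; rfl
    have h1 := h x (hPr x x.2)
    rw [h0, sub_zero] at h1
    have h2 : ‖(x : E)‖ = 0 := by nlinarith [norm_nonneg (x : E)]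
    exact Subtype.ext (norm_eq_zero.1 h2)
  have hsurj : Function.Surjective f :=
    (LinearMap.injective_iff_surjective_of_finrank_eq_finrank hr).1 hinj
  obtain ⟨⟨x, hx⟩, hxy⟩ := hsurj ⟨y, ⟨y, hy⟩⟩
  have hxy' : Q x = y := by rw [← hf ⟨x, hx⟩, hxy]
  have hPx := hPr x hx
  rcases eq_or_ne x 0 with rfl | hx0
  · rw [map_zero] at hxy'
    simp [← hxy']
  have hxn : 0 < ‖x‖ := norm_pos_iff.2 hx0
  have h1 := hQ.norm_sub_sq x
  rw [hxy'] at h1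
  have h2 : ‖x - y‖ ^ 2 ≤ (c * ‖x‖) ^ 2 := by
    have := h x hPx
    rw [hxy'] at this
    gcongr
  have h3 : ⟪y, x⟫_ℝ = ‖y‖ ^ 2 := by
    have h4 : ⟪Q x, y⟫_ℝ = ⟪x, y⟫_ℝ := by rw [hQ.symm, hy]
    rw [← real_inner_self_eq_norm_sq, real_inner_comm, ← h4, hxy']
  -- t • x is the orthogonal projection of `y` to the line of `x`, and the angle between `x` and `y
  -- = Q x` is the same seen from either side.
  set t := ‖y‖ ^ 2 / ‖x‖ ^ 2 with ht
  have ht' : t * ‖x‖ ^ 2 = ‖y‖ ^ 2 := by rw [ht]; field_simp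
  have e : y - P y = (y - t • x) - P (y - t • x) := by
    rw [map_sub, map_smul, hPx]; abel
  refine le_of_sq_le_sq ?_ (by positivity)
  calc ‖y - P y‖ ^ 2 ≤ ‖y - t • x‖ ^ 2 := by
        rw [e]; gcongr; exact hP.norm_sub_apply_le _
    _ = ‖y‖ ^ 2 - t * ‖y‖ ^ 2 := by
        rw [norm_sub_sq_real, inner_smul_right, h3, norm_smul, mul_pow, Real.norm_eq_abs, sq_abs]
        linear_combination t * ht'
    _ = t * (‖x‖ ^ 2 - ‖y‖ ^ 2) := by linear_combination -ht'
    _ ≤ t * (c * ‖x‖) ^ 2 := by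
        rw [← h1]
        gcongr
    _ = _ := by rw [mul_pow, mul_pow, ← ht']; ring

/-- The distance of projections of equal rank. -/
theorem IsOrthProj.norm_sub_apply_le_of_ker [FiniteDimensional ℝ E] {P Q : E →L[ℝ] E}
    (hP : IsOrthProj P) (hQ : IsOrthProj Q)
    (hr : Module.finrank ℝ (LinearMap.range (P : E →ₗ[ℝ] E)) =
      Module.finrank ℝ (LinearMap.range (Q : E →ₗ[ℝ] E)))
    {c : ℝ} (hc : 0 ≤ c) (h : ∀ x, Q x = 0 → ‖P x‖ ≤ c * ‖x‖) (x : E) :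
    ‖P x - Q x‖ ≤ c * ‖x‖ := by
  have h1 : ‖Q x - P (Q x)‖ ≤ c * ‖Q x‖ :=
    hP.norm_sub_le_symm hQ hr hc (fun z hz => hP.norm_sub_le_of_ker hQ hc h hz) (hQ.idem x)
  have h2 : ‖P (x - Q x)‖ ≤ c * ‖x - Q x‖ := h _ (by rw [map_sub, hQ.idem, sub_self])
  -- The two parts are orthogonal, and so are their arguments x - Q x and Q x; Pythagoras on both
  -- sides gives the constant `c` itself, with no factor 2.
  have e : P x - Q x = P (x - Q x) - (Q x - P (Q x)) := by rw [map_sub]; abel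
  have ho : ⟪P (x - Q x), Q x - P (Q x)⟫_ℝ = 0 := by
    rw [hP.symm, map_sub P (Q x), hP.idem, sub_self, inner_zero_right]
  refine le_of_sq_le_sq ?_ (by positivity)
  calc ‖P x - Q x‖ ^ 2 = ‖P (x - Q x)‖ ^ 2 + ‖Q x - P (Q x)‖ ^ 2 := by
        rw [e, norm_sub_sq_real, ho]; ring
    _ ≤ (c * ‖x - Q x‖) ^ 2 + (c * ‖Q x‖) ^ 2 := by gcongr
    _ = (c * ‖x‖) ^ 2 := by rw [mul_pow, mul_pow, hQ.norm_sub_sq]; ring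

end Gap

/-! ### The smallest nonzero singular value -/

section Sigma

variable {E F : Type*} [NormedAddCommGroup E] [InnerProductSpace ℝ E] [FiniteDimensional ℝ E]
  [NormedAddCommGroup F] [InnerProductSpace ℝ F] [FiniteDimensional ℝ F]

/-- The smallest nonzero singular value of a linear map (zero for the zero map). -/
def minSingularValue (T : E →ₗ[ℝ] F) : ℝ :=
  sInf {s : ℝ | 0 < s ∧ ∃ i : ℕ, T.singularValues i = s}

theorem minSingularValue_pos {T : E →ₗ[ℝ] F} (hT : T ≠ 0) : 0 < minSingularValue T := by
  have hfin : {s : ℝ | 0 < s ∧ ∃ i : ℕ, T.singularValues i = s}.Finite := by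
    refine (T.singularValues.support.image T.singularValues).finite_toSet.subset ?_
    rintro s ⟨hs, i, rfl⟩
    simp only [Finset.coe_image, Set.mem_image]
    exact ⟨i, Finsupp.mem_support_iff.2 hs.ne', rfl⟩
  have hne : {s : ℝ | 0 < s ∧ ∃ i : ℕ, T.singularValues i = s}.Nonempty := by
    rw [Ne, ← LinearMap.singularValues_eq_zero_iff] at hT
    obtain ⟨i, hi⟩ := Finsupp.ne_iff.1 hT
    exact ⟨_, (T.singularValues_pos_iff_ne_zero i).2 hi, i, rfl⟩
  exact (hne.csInf_mem hfin).1

theorem minSingularValue_nonneg (T : E →ₗ[ℝ] F) : 0 ≤ minSingularValue T :=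
  Real.sInf_nonneg fun _ hs => hs.1.le

theorem minSingularValue_le {T : E →ₗ[ℝ] F} {i : ℕ} (hi : 0 < T.singularValues i) :
    minSingularValue T ≤ T.singularValues i :=
  csInf_le ⟨0, fun _ hs => hs.1.le⟩ ⟨hi, i, rfl⟩

/-- A vector in the range of the adjoint is orthogonal to the kernel of `T`, so in an eigenbasis of
T*T only coordinates with nonzero singular value occur. -/
theorem minSingularValue_mul_norm_adjoint_le (T : E →ₗ[ℝ] F) (u : F) :
    minSingularValue T * ‖T.adjoint u‖ ≤ ‖T (T.adjoint u)‖ := by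
  set w := T.adjoint u with hw
  have hS := T.isSymmetric_adjoint_comp_self
  let e := hS.eigenvectorBasis rfl
  have h1 : ‖T w‖ ^ 2 = ∑ i : Fin (Module.finrank ℝ E), T.singularValues i ^ 2 * ⟪e i, w⟫_ℝ ^ 2 := by
    have : ‖T w‖ ^ 2 = ⟪w, (T.adjoint ∘ₗ T) w⟫_ℝ := by
      rw [LinearMap.comp_apply, LinearMap.adjoint_inner_right, real_inner_self_eq_norm_sq]
    rw [this, ← e.sum_inner_mul_inner]
    refine Finset.sum_congr rfl fun i _ => ?_
    have h2 : ⟪e i, (T.adjoint ∘ₗ T) w⟫_ℝ = T.singularValues i ^ 2 * ⟪e i, w⟫_ℝ := by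
      rw [← hS, hS.apply_eigenvectorBasis, T.sq_singularValues_fin rfl, inner_smul_left]
      rfl
    rw [h2, real_inner_comm]
    ring
  have h3 : ‖w‖ ^ 2 = ∑ i, ⟪e i, w⟫_ℝ ^ 2 := by
    rw [← real_inner_self_eq_norm_sq, ← e.sum_inner_mul_inner]
    refine Finset.sum_congr rfl fun i _ => ?_
    rw [real_inner_comm]
    ring
  refine le_of_sq_le_sq ?_ (norm_nonneg _)
  rw [mul_pow, h1, h3, Finset.mul_sum]
  refine Finset.sum_le_sum fun i _ => ?_
  rcases (T.singularValues_nonneg i).eq_or_lt with h0 | h0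
  · have hTe : T (e i) = 0 := by
      have h5 : (T.adjoint ∘ₗ T) (e i) = 0 := by
        rw [hS.apply_eigenvectorBasis, ← T.sq_singularValues_fin rfl, ← h0]
        simp
      have h6 : ‖T (e i)‖ ^ 2 = 0 := by
        rw [← real_inner_self_eq_norm_sq, ← LinearMap.adjoint_inner_right, ← LinearMap.comp_apply,
          h5, inner_zero_right]
      simpa using h6
    have h7 : ⟪e i, w⟫_ℝ = 0 := by
      rw [hw, LinearMap.adjoint_inner_right, hTe, inner_zero_left]
    rw [h7]
    simp
  · gcongr
    · exact minSingularValue_nonneg T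
    · exact minSingularValue_le h0

/-- This is the previous bound for the adjoint, obtained without comparing the two spectra: write T
u = T w with w in the range of the adjoint and use ‖T w‖² ≤ ‖w‖ ‖T*T w‖. -/
theorem minSingularValue_mul_norm_apply_le (T : E →ₗ[ℝ] F) (u : E) :
    minSingularValue T * ‖T u‖ ≤ ‖T.adjoint (T u)‖ := by
  have hr : T u ∈ LinearMap.range (T ∘ₗ T.adjoint) := by
    rw [← LinearMap.adjoint_adjoint T, LinearMap.adjoint_adjoint T.adjoint,
      LinearMap.range_adjoint_comp_self, LinearMap.adjoint_adjoint]
    exact ⟨u, rfl⟩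
  obtain ⟨z, hz⟩ := hr
  rw [LinearMap.comp_apply] at hz
  rw [← hz]
  set w := T.adjoint z with hw
  have h1 := minSingularValue_mul_norm_adjoint_le T z
  rw [← hw] at h1
  have h2 : ‖T w‖ ^ 2 ≤ ‖w‖ * ‖T.adjoint (T w)‖ := by
    rw [← real_inner_self_eq_norm_sq, ← LinearMap.adjoint_inner_right]
    exact real_inner_le_norm _ _
  rcases (norm_nonneg (T w)).eq_or_lt with h0 | h0
  · rw [← h0, mul_zero]; exact norm_nonneg _
  refine le_of_mul_le_mul_left ?_ h0
  calc ‖T w‖ * (minSingularValue T * ‖T w‖) = minSingularValue T * ‖T w‖ ^ 2 := by ring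
    _ ≤ minSingularValue T * (‖w‖ * ‖T.adjoint (T w)‖) := by
      gcongr
      exact minSingularValue_nonneg T
    _ = (minSingularValue T * ‖w‖) * ‖T.adjoint (T w)‖ := by ring
    _ ≤ _ := by gcongr

end Sigma

/-! ### The constants of the rate -/

theorem vcg_sq {k₁ k₂ ε : ℝ} (h : 0 ≤ gamma₂ k₁ k₂ ε) :
    vcg k₁ k₂ ε ^ 2 = gamma₁ k₁ k₂ ε * vcg k₁ k₂ ε + gamma₂ k₁ k₂ ε := by
  have h1 : 0 ≤ gamma₁ k₁ k₂ ε ^ 2 + 4 * gamma₂ k₁ k₂ ε := by positivity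
  have h2 := Real.sq_sqrt h1
  unfold vcg
  linear_combination h2 / 4

theorem gamma₁_le_vcg {k₁ k₂ ε : ℝ} (h : 0 ≤ gamma₂ k₁ k₂ ε) :
    gamma₁ k₁ k₂ ε ≤ vcg k₁ k₂ ε := by
  have h2 : gamma₁ k₁ k₂ ε ≤ √(gamma₁ k₁ k₂ ε ^ 2 + 4 * gamma₂ k₁ k₂ ε) :=
    Real.le_sqrt_of_sq_le (by linarith)
  unfold vcg
  linarith

/-- Squaring √(γ₁² + 4γ₂) < 2 - γ₁ turns it into γ₁ + γ₂ < 1; the right side is positive because γ₂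
≥ 0. -/
theorem vcg_lt_one {k₁ k₂ ε : ℝ} (h : 0 ≤ gamma₂ k₁ k₂ ε)
    (hlt : gamma₁ k₁ k₂ ε + gamma₂ k₁ k₂ ε < 1) : vcg k₁ k₂ ε < 1 := by
  have h2 : √(gamma₁ k₁ k₂ ε ^ 2 + 4 * gamma₂ k₁ k₂ ε) < 2 - gamma₁ k₁ k₂ ε := by
    rw [Real.sqrt_lt' (by linarith)]
    nlinarith
  unfold vcg
  linarith

/-- A coupled two-term recursion for errors `d` and directions `s`. -/
theorem coupled_recursion_le {d s : ℕ → ℝ} {A κ v : ℝ} (hA : 0 ≤ A) (hκ : 0 ≤ κ) (hAv : A ≤ v)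
    (hv : v ^ 2 = (A + κ) * v + 2 * κ) (hd0 : 0 ≤ d 0) (hs0 : s 0 = 0)
    (hd : ∀ l, d l ≤ d 0 → d (l + 1) ≤ A * d l + κ * s l)
    (hs : ∀ l, d l ≤ d 0 → s (l + 1) ≤ (2 + A) * d l + κ * s l) (hv1 : v ≤ 1) (l : ℕ) :
    d l ≤ v ^ l * d 0 := by
  have hv0 : 0 ≤ v := hA.trans hAv
  -- `v` is an eigenvalue of the recursion matrix with rows (A, κ) and (2 + A, κ), and the invariant
  -- compares (d, s) with its eigenvector; multiplying the second entry by κ avoids dividing by κ.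
  suffices h : d l ≤ v ^ l * d 0 ∧ κ * s l ≤ (v - A) * (v ^ l * d 0) from h.1
  induction l with
  | zero =>
    refine ⟨by simp, ?_⟩
    rw [hs0, mul_zero]
    have : 0 ≤ v - A := by linarith
    positivity
  | succ l ih =>
    obtain ⟨h1, h2⟩ := ih
    have h3 : d l ≤ d 0 := h1.trans (mul_le_of_le_one_left hd0 (pow_le_one₀ hv0 hv1))
    have h4 : A * d l ≤ A * (v ^ l * d 0) := by gcongr
    refine ⟨?_, ?_⟩
    · calc d (l + 1) ≤ A * d l + κ * s l := hd l h3
        _ ≤ A * (v ^ l * d 0) + (v - A) * (v ^ l * d 0) := add_le_add h4 h2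
        _ = _ := by rw [pow_succ]; ring
    · calc κ * s (l + 1) ≤ κ * ((2 + A) * d l + κ * s l) := by gcongr; exact hs l h3
        _ ≤ κ * ((2 + A) * (v ^ l * d 0) + (v - A) * (v ^ l * d 0)) := by gcongr
        _ = (v - A) * (v ^ (l + 1) * d 0) := by
          rw [pow_succ]; linear_combination -(v ^ l * d 0) * hv

theorem vcg_zero_zero {ε : ℝ} (hε : 0 < ε) (hε1 : 4 * ε < 1) :
    vcg 0 0 ε = 18 * ε / (1 - 4 * ε) := by
  have h1 : gamma₁ 0 0 ε = 18 * ε / (1 - 4 * ε) := by simp [gamma₁]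
  have h2 : gamma₂ 0 0 ε = 0 := by simp [gamma₂]
  have h3 : 0 ≤ 18 * ε / (1 - 4 * ε) := div_nonneg (by linarith) (by linarith)
  rw [vcg, h1, h2, mul_zero, add_zero, Real.sqrt_sq h3]
  ring

open Filter Topology

theorem tendsto_gamma {k₁ k₂ : ℝ} (h : k₁ ≠ 1) :
    Tendsto (fun ε => gamma₁ k₁ k₂ ε + gamma₂ k₁ k₂ ε) (𝓝 0) (𝓝 (3 * k₁ * k₂)) := by
  have hc : ContinuousAt (fun ε => gamma₁ k₁ k₂ ε + gamma₂ k₁ k₂ ε) 0 := by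
    unfold gamma₁ gamma₂
    have : 1 - k₁ ≠ 0 := sub_ne_zero.2 h.symm
    fun_prop (disch := simp [this])
  have e : gamma₁ k₁ k₂ 0 + gamma₂ k₁ k₂ 0 = 3 * k₁ * k₂ := by
    simp [gamma₁, gamma₂]; ring
  have := hc.tendsto
  rwa [e] at this

theorem eventually_gamma_lt_one {k₁ k₂ : ℝ} (h : k₁ * k₂ < 1 / 3) :
    ∀ᶠ ε in 𝓝[>] 0, gamma₁ k₁ k₂ ε + gamma₂ k₁ k₂ ε < 1 := by
  -- For k₁ = 1 the first denominator is -8ε, and the first quotient of γ₁ equals -(1 - 5ε) for ε ≠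
  -- 0. The limit is then 3k₂ - 1, still below 1.
  by_cases h1 : k₁ = 1
  · subst h1
    have hc : Tendsto (fun ε : ℝ => -(1 - 5 * ε) + (4 * k₂ * ε + 1 * k₂) / (1 - 4 * ε) +
        gamma₂ 1 k₂ ε) (𝓝 0) (𝓝 (-1 + 3 * k₂)) := by
      have hc : ContinuousAt (fun ε : ℝ => -(1 - 5 * ε) + (4 * k₂ * ε + 1 * k₂) / (1 - 4 * ε) +
        gamma₂ 1 k₂ ε) 0 := by
        unfold gamma₂
        fun_prop (disch := simp)
      have := hc.tendsto
      convert! this using 2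
      simp [gamma₂]; ring
    have h2 : ∀ᶠ ε : ℝ in 𝓝[>] 0, -(1 - 5 * ε) + (4 * k₂ * ε + 1 * k₂) / (1 - 4 * ε) +
        gamma₂ 1 k₂ ε < 1 :=
      (hc.mono_left nhdsWithin_le_nhds).eventually_lt_const (by linarith)
    filter_upwards [h2, self_mem_nhdsWithin] with ε h3 h4
    have h5 : ε ≠ 0 := (Set.mem_Ioi.1 h4).ne'
    refine lt_of_eq_of_lt ?_ h3
    unfold gamma₁
    congr 2
    rw [show (1 - 4 * ε) - 1 * (1 + 4 * ε) = -8 * ε by ring]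
    field_simp
    ring
  · exact ((tendsto_gamma h1).mono_left nhdsWithin_le_nhds).eventually_lt_const (by linarith)

theorem standard_parameters {ε : ℝ} (hε : 0 < ε) (hε1 : ε ≤ 0.01) :
    0 < (1 - 4 * ε) - 0.1 * (1 + 4 * ε) ∧ gamma₁ 0.1 1 ε + gamma₂ 0.1 1 ε < 1 := by
  norm_num at hε1
  refine ⟨by linarith, ?_⟩
  -- The three quotients are bounded separately; 0.3 + 0.2 + 0.4 < 1.
  have h1 : (18 * ε - 10 * 0.1 * ε * (1 + 4 * ε)) / ((1 - 4 * ε) - 0.1 * (1 + 4 * ε)) ≤ 0.3 := by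
    rw [div_le_iff₀ (by linarith)]
    nlinarith
  have h2 : (4 * 1 * ε + 0.1 * 1) / (1 - 4 * ε) ≤ 0.2 := by
    rw [div_le_iff₀ (by linarith)]
    linarith
  have h3 : (8 * 1 * ε + 2 * 0.1 * 1) / (1 - 4 * ε) ≤ 0.4 := by
    rw [div_le_iff₀ (by linarith)]
    linarith
  unfold gamma₁ gamma₂
  linarith

/-! ### Frobenius norms of matrices -/

section Frobenius

open Matrix

variable {m n l : Type*} [Fintype m] [Fintype n] [Fintype l]

/-- The squared Frobenius norm. -/
def frobSq (M : Matrix m n ℝ) : ℝ := (Mᵀ * M).trace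

theorem frobSq_eq_sum (M : Matrix m n ℝ) : frobSq M = ∑ j, ∑ i, M i j ^ 2 := by
  simp [frobSq, Matrix.trace, Matrix.mul_apply, sq]

theorem frobSq_nonneg (M : Matrix m n ℝ) : 0 ≤ frobSq M := by
  rw [frobSq_eq_sum]; positivity

theorem frobSq_transpose (M : Matrix m n ℝ) : frobSq Mᵀ = frobSq M := by
  rw [frobSq, transpose_transpose, trace_mul_comm, frobSq]

/-! ### Partial isometries -/

/-- If `Uᵀ U` is a projection then `U Uᵀ U = U`. -/
theorem mul_eq_self_of_transpose_mul_self {U : Matrix m n ℝ} {G : Matrix n n ℝ} (h : Uᵀ * U = G)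
    (hG : G * G = G) : U * G = U := by
  have hGs : Gᵀ = G := by rw [← h, transpose_mul, transpose_transpose]
  have h0 : (U * G - U)ᴴ * (U * G - U) = 0 := by
    rw [conjTranspose_eq_transpose_of_trivial, transpose_sub, transpose_mul, hGs]
    have e : (G * Uᵀ - Uᵀ) * (U * G - U) =
        G * (Uᵀ * U) * G - G * (Uᵀ * U) - (Uᵀ * U) * G + Uᵀ * U := by
      simp only [Matrix.sub_mul, Matrix.mul_sub, Matrix.mul_assoc]
      abel
    rw [e, h, hG, hG]
    abel
  rw [conjTranspose_mul_self_eq_zero] at h0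
  exact sub_eq_zero.1 h0

variable [DecidableEq n]

theorem toEuclideanLin_mul_apply {m : Type*} [DecidableEq l] (A : Matrix m n ℝ) (B : Matrix n l ℝ)
    (x : EuclideanSpace ℝ l) :
    toEuclideanLin (A * B) x = toEuclideanLin A (toEuclideanLin B x) := by
  simp [toLpLin_apply]

theorem norm_toEuclideanLin_sq (A : Matrix m n ℝ) (x : EuclideanSpace ℝ n) :
    ‖toEuclideanLin A x‖ ^ 2 = ∑ i, (∑ j, A i j * x j) ^ 2 := by
  rw [EuclideanSpace.norm_sq_eq]
  simp [toLpLin_apply, Matrix.mulVec, dotProduct]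

theorem norm_toEuclideanLin_sq_le (A : Matrix m n ℝ) (x : EuclideanSpace ℝ n) :
    ‖toEuclideanLin A x‖ ^ 2 ≤ frobSq A * ‖x‖ ^ 2 := by
  rw [norm_toEuclideanLin_sq, EuclideanSpace.norm_sq_eq, frobSq_eq_sum, Finset.sum_comm,
    Finset.sum_mul]
  refine Finset.sum_le_sum fun i _ => ?_
  simpa using Finset.sum_mul_sq_le_sq_mul_sq Finset.univ (fun j => A i j) (fun j => x j)

theorem frobSq_mul_le {A : Matrix m n ℝ} {c : ℝ}
    (h : ∀ x, ‖toEuclideanLin A x‖ ≤ c * ‖x‖) (B : Matrix n l ℝ) :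
    frobSq (A * B) ≤ c ^ 2 * frobSq B := by
  rw [frobSq_eq_sum, frobSq_eq_sum, Finset.mul_sum]
  refine Finset.sum_le_sum fun j _ => ?_
  have h1 := pow_le_pow_left₀ (norm_nonneg _) (h (WithLp.toLp 2 fun i => B i j)) 2
  rw [mul_pow, norm_toEuclideanLin_sq, EuclideanSpace.norm_sq_eq] at h1
  simpa [Matrix.mul_apply] using h1

theorem frobSq_mul_le_right {n : Type*} [Fintype n] [DecidableEq l] {B : Matrix l n ℝ} {c : ℝ}
    (h : ∀ x, ‖toEuclideanLin Bᵀ x‖ ≤ c * ‖x‖) (A : Matrix m l ℝ) :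
    frobSq (A * B) ≤ c ^ 2 * frobSq A := by
  rw [← frobSq_transpose, transpose_mul, ← frobSq_transpose A]
  exact frobSq_mul_le h _

/-! ### Projection matrices -/

theorem inner_toEuclideanLin_transpose [DecidableEq m] (A : Matrix m n ℝ) (x : EuclideanSpace ℝ m)
    (y : EuclideanSpace ℝ n) :
    ⟪toEuclideanLin Aᵀ x, y⟫_ℝ = ⟪x, toEuclideanLin A y⟫_ℝ := by
  have h := toEuclideanLin_conjTranspose_eq_adjoint A
  rw [conjTranspose_eq_transpose_of_trivial] at h
  rw [h, LinearMap.adjoint_inner_left]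

theorem adjoint_toEuclideanLin [DecidableEq m] (A : Matrix m n ℝ) :
    (toEuclideanLin A).adjoint = toEuclideanLin Aᵀ := by
  rw [← toEuclideanLin_conjTranspose_eq_adjoint, conjTranspose_eq_transpose_of_trivial]

theorem isOrthProj_toEuclideanLin {P : Matrix n n ℝ} (hs : Pᵀ = P) (hi : P * P = P) :
    IsOrthProj (LinearMap.toContinuousLinearMap (toEuclideanLin P)) where
  symm x y := by
    have := inner_toEuclideanLin_transpose P x y
    rw [hs] at this
    exact this
  idem x := by
    change toEuclideanLin P (toEuclideanLin P x) = toEuclideanLin P x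
    rw [← toEuclideanLin_mul_apply, hi]

theorem norm_one_sub_proj_le {P : Matrix n n ℝ} (hs : Pᵀ = P) (hi : P * P = P)
    (x : EuclideanSpace ℝ n) : ‖toEuclideanLin (1 - P) x‖ ≤ 1 * ‖x‖ := by
  have h := (isOrthProj_toEuclideanLin hs hi).norm_sub_apply_le x
  rw [map_sub, one_mul]
  simpa [toLpLin_apply] using h

theorem finrank_range_toEuclideanLin (A : Matrix m n ℝ) :
    Module.finrank ℝ (LinearMap.range (toEuclideanLin A)) = A.rank := by
  change Module.finrank ℝ (LinearMap.range (toLpLin 2 2 A)) = _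
  rw [toLpLin_eq_toLin]
  exact (A.rank_eq_finrank_range_toLin _ _).symm

/-- The distance of the projections onto the row spaces of `X` and `Y`, where `σ` is a lower bound
for the nonzero singular values of `X`. -/
theorem norm_proj_sub_le [DecidableEq m] {X Y : Matrix m n ℝ} {P Q : Matrix n n ℝ} (hPs : Pᵀ = P)
    (hPi : P * P = P) (hQs : Qᵀ = Q) (hQi : Q * Q = Q) (hr : P.rank = Q.rank) {σ δ : ℝ}
    (hσ : 0 < σ) (hσX : ∀ u, σ * ‖toEuclideanLin Xᵀ u‖ ≤ ‖toEuclideanLin X (toEuclideanLin Xᵀ u)‖)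
    (hXP : X * P = X) (hYQ : Y * Q = Y)
    (hran : LinearMap.range (toEuclideanLin P) ≤ LinearMap.range (toEuclideanLin Xᵀ))
    (hδ : 0 ≤ δ) (hXY : frobSq (X - Y) ≤ δ ^ 2) (x : EuclideanSpace ℝ n) :
    ‖toEuclideanLin (P - Q) x‖ ≤ δ / σ * ‖x‖ := by
  rw [map_sub]
  refine (isOrthProj_toEuclideanLin hPs hPi).norm_sub_apply_le_of_ker
    (isOrthProj_toEuclideanLin hQs hQi) ?_ (by positivity) (fun z hz => ?_) x
  · change Module.finrank ℝ (LinearMap.range (toEuclideanLin P)) =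
      Module.finrank ℝ (LinearMap.range (toEuclideanLin Q))
    rw [finrank_range_toEuclideanLin, finrank_range_toEuclideanLin, hr]
  · change ‖toEuclideanLin P z‖ ≤ _
    change toEuclideanLin Q z = 0 at hz
    -- For z in the kernel of `Q` one has Y z = 0, so σ‖P z‖ ≤ ‖X P z‖ = ‖X z‖ = ‖(X - Y) z‖.
    obtain ⟨u, hu⟩ := hran ⟨z, rfl⟩
    have h1 := hσX u
    rw [hu, ← toEuclideanLin_mul_apply, hXP] at h1
    have h2 : toEuclideanLin X z = toEuclideanLin (X - Y) z := by
      have h3 : toEuclideanLin Y z = 0 := by rw [← hYQ, toEuclideanLin_mul_apply, hz, map_zero]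
      rw [map_sub, LinearMap.sub_apply, h3, sub_zero]
    have h4 : ‖toEuclideanLin (X - Y) z‖ ≤ δ * ‖z‖ := by
      refine le_of_sq_le_sq ((norm_toEuclideanLin_sq_le _ _).trans ?_) (by positivity)
      rw [mul_pow]
      gcongr
    rw [h2] at h1
    rw [div_mul_eq_mul_div, le_div_iff₀ hσ, mul_comm]
    exact h1.trans h4

end Frobenius

/-! ### Tensors through their slices in the transform domain -/

section Slices

open Matrix

variable {a b c d : ℕ}

/-- The `k`-th frontal slice in the transform domain. -/
def hat (A : Tensor a b c) (k : Fin c) : Matrix (Fin a) (Fin b) ℝ := slice (dct A) k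

theorem hat_add (A B : Tensor a b c) (k : Fin c) : hat (A + B) k = hat A k + hat B k := by
  rw [hat, dct_add]; rfl

theorem hat_smul (t : ℝ) (A : Tensor a b c) (k : Fin c) : hat (t • A) k = t • hat A k := by
  rw [hat, dct_smul]; rfl

theorem hat_sub (A B : Tensor a b c) (k : Fin c) : hat (A - B) k = hat A k - hat B k := by
  rw [sub_eq_add_neg, ← neg_one_smul ℝ B, hat_add, hat_smul, neg_one_smul, sub_eq_add_neg]

theorem hat_idct (A : Tensor a b c) (k : Fin c) : hat (idct A) k = slice A k := by
  rw [hat, dct_idct]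

theorem hat_tprod (A : Tensor a b c) (B : Tensor b d c) (k : Fin c) :
    hat (A ∗ₜ B) k = hat A k * hat B k := by
  have h : blockDiag (bdiag A * bdiag B) k = hat A k * hat B k := by
    rw [bdiag, bdiag, ← blockDiagonal_mul, blockDiag_blockDiagonal]
    rfl
  rw [tprod, hat_idct, ← h]
  rfl

theorem hat_tr (A : Tensor a b c) (k : Fin c) : hat (tr A) k = (hat A k)ᵀ := by
  have h : blockDiag (bdiag A)ᵀ k = (hat A k)ᵀ := by
    rw [bdiag, blockDiagonal_transpose, blockDiag_blockDiagonal]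
    rfl
  rw [tr, hat_idct, ← h]
  rfl

theorem hat_ext {A B : Tensor a b c} (h : ∀ k, hat A k = hat B k) : A = B := by
  rw [← idct_dct A, ← idct_dct B]
  congr 1
  ext ⟨i, j, k⟩
  exact congrFun (congrFun (h k) i) j

/-- Orthogonality of the transform matrix, tube by tube; this lets Frobenius norms be computed
slicewise in the transform domain. -/
theorem inner_dct (A B : Tensor a b c) : ⟪dct A, dct B⟫_ℝ = ⟪A, B⟫_ℝ := by
  have key : ∀ i j, ∑ k, dct A (i, j, k) * dct B (i, j, k) = ∑ k, A (i, j, k) * B (i, j, k) := by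
    intro i j
    have h : (dctMatrix c *ᵥ fun l => A (i, j, l)) ⬝ᵥ (dctMatrix c *ᵥ fun l => B (i, j, l)) =
        (fun l => A (i, j, l)) ⬝ᵥ fun l => B (i, j, l) := by
      rw [dotProduct_mulVec, ← mulVec_transpose, mulVec_mulVec, transpose_mul_dctMatrix,
        one_mulVec]
    exact h
  simp only [PiLp.inner_apply, Fintype.sum_prod_type, RCLike.inner_apply, conj_trivial]
  refine Finset.sum_congr rfl fun i _ => Finset.sum_congr rfl fun j _ => ?_
  simpa only [mul_comm] using key i j

theorem inner_eq_sum_trace (A B : Tensor a b c) :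
    ⟪A, B⟫_ℝ = ∑ k, ((hat A k)ᵀ * hat B k).trace := by
  rw [← inner_dct]
  simp only [PiLp.inner_apply, Fintype.sum_prod_type, RCLike.inner_apply, conj_trivial,
    Matrix.trace, Matrix.diag_apply, Matrix.mul_apply, Matrix.transpose_apply]
  rw [Finset.sum_comm' (t' := Finset.univ) (s' := fun _ => Finset.univ) (by simp)]
  conv_rhs => rw [Finset.sum_comm]
  refine Finset.sum_congr rfl fun j _ => ?_
  rw [Finset.sum_comm]
  refine Finset.sum_congr rfl fun k _ => Finset.sum_congr rfl fun i _ => ?_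
  rw [mul_comm]
  rfl

theorem norm_sq_eq_sum_frobSq (A : Tensor a b c) : ‖A‖ ^ 2 = ∑ k, frobSq (hat A k) := by
  rw [← real_inner_self_eq_norm_sq, inner_eq_sum_trace]
  rfl

theorem frobSq_hat_le (A : Tensor a b c) (k : Fin c) : frobSq (hat A k) ≤ ‖A‖ ^ 2 := by
  rw [norm_sq_eq_sum_frobSq]
  exact Finset.single_le_sum (f := fun k => frobSq (hat A k)) (fun _ _ => frobSq_nonneg _)
    (Finset.mem_univ k)

theorem norm_le_of_hat {A : Tensor a b c} {a' b' : ℕ} {B : Tensor a' b' c} {t : ℝ} (ht : 0 ≤ t)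
    (h : ∀ k, frobSq (hat A k) ≤ t ^ 2 * frobSq (hat B k)) : ‖A‖ ≤ t * ‖B‖ := by
  refine le_of_sq_le_sq ?_ (by positivity)
  rw [mul_pow, norm_sq_eq_sum_frobSq, norm_sq_eq_sum_frobSq, Finset.mul_sum]
  exact Finset.sum_le_sum fun k _ => h k

theorem hat_tangentProj (U : Tensor a d c) (V : Tensor b d c) (Z : Tensor a b c) (k : Fin c) :
    hat (tangentProj U V Z) k = hat U k * (hat U k)ᵀ * hat Z k + hat Z k * (hat V k * (hat V k)ᵀ) -
      hat U k * (hat U k)ᵀ * hat Z k * (hat V k * (hat V k)ᵀ) := by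
  change hat (U ∗ₜ tr U ∗ₜ Z + Z ∗ₜ V ∗ₜ tr V - U ∗ₜ tr U ∗ₜ Z ∗ₜ V ∗ₜ tr V) k = _
  simp only [hat_sub, hat_add, hat_tprod, hat_tr, Matrix.mul_assoc]

/-! ### Frames -/

/-- The slices in the transform domain are partial isometries of ranks `r`, with vanishing columns
beyond the rank. -/
def IsFrame (r : Fin c → ℕ) (U : Tensor a (maxRank r) c) : Prop := tr U ∗ₜ U = partialId r

theorem hat_partialId (r : Fin c → ℕ) (k : Fin c) :
    hat (partialId r) k = diagonal fun i => if i.val < r k then 1 else 0 := by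
  rw [partialId, hat_idct]
  ext i j
  simp only [slice, Matrix.of_apply, mk_apply, diagonal_apply]
  by_cases h : i = j <;> simp [h]

theorem hat_partialId_mul_self (r : Fin c → ℕ) (k : Fin c) :
    hat (partialId r) k * hat (partialId r) k = hat (partialId r) k := by
  rw [hat_partialId, diagonal_mul_diagonal]
  congr 1
  ext i
  split_ifs <;> simp

theorem le_maxRank (r : Fin c → ℕ) (k : Fin c) : r k ≤ maxRank r :=
  Finset.le_sup (Finset.mem_univ k)

theorem card_filter_val_lt {n s : ℕ} (h : s ≤ n) :
    ∑ i : Fin n, (if i.val < s then (1 : ℝ) else 0) = s := by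
  rw [Fin.sum_univ_eq_sum_range (fun i => if i < s then (1 : ℝ) else 0), Finset.sum_ite,
    Finset.sum_const_zero, add_zero, Finset.sum_const, nsmul_eq_mul, mul_one]
  congr 1
  rw [show {x ∈ Finset.range n | x < s} = Finset.range s by ext; simp; omega, Finset.card_range]

theorem trace_hat_partialId (r : Fin c → ℕ) (k : Fin c) : (hat (partialId r) k).trace = r k := by
  rw [hat_partialId, trace_diagonal, card_filter_val_lt (le_maxRank r k)]

namespace IsFrame

variable {r : Fin c → ℕ} {U : Tensor a (maxRank r) c}

theorem transpose_mul_self (h : IsFrame r U) (k : Fin c) :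
    (hat U k)ᵀ * hat U k = hat (partialId r) k := by
  rw [← h, hat_tprod, hat_tr]

theorem mul_partialId (h : IsFrame r U) (k : Fin c) : hat U k * hat (partialId r) k = hat U k :=
  mul_eq_self_of_transpose_mul_self (h.transpose_mul_self k) (hat_partialId_mul_self r k)

theorem proj_mul (h : IsFrame r U) (k : Fin c) : hat U k * (hat U k)ᵀ * hat U k = hat U k := by
  rw [Matrix.mul_assoc, h.transpose_mul_self, h.mul_partialId]

theorem proj_transpose (U : Tensor a d c) (k : Fin c) :
    (hat U k * (hat U k)ᵀ)ᵀ = hat U k * (hat U k)ᵀ := by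
  rw [transpose_mul, transpose_transpose]

theorem proj_mul_proj (h : IsFrame r U) (k : Fin c) :
    hat U k * (hat U k)ᵀ * (hat U k * (hat U k)ᵀ) = hat U k * (hat U k)ᵀ := by
  rw [← Matrix.mul_assoc, h.proj_mul]

theorem rank_hat (h : IsFrame r U) (k : Fin c) :
    (hat U k).rank = (hat (partialId r) k).rank := by
  rw [← h.transpose_mul_self, rank_transpose_mul_self]

theorem rank_proj (h : IsFrame r U) (k : Fin c) :
    (hat U k * (hat U k)ᵀ).rank = (hat (partialId r) k).rank := by
  rw [rank_self_mul_transpose, h.rank_hat]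

theorem trace_proj (h : IsFrame r U) (k : Fin c) : (hat U k * (hat U k)ᵀ).trace = r k := by
  rw [trace_mul_comm, h.transpose_mul_self, trace_hat_partialId]

end IsFrame

theorem isOrthProj_tangentProj {r : Fin c → ℕ} {U : Tensor a (maxRank r) c}
    {V : Tensor b (maxRank r) c} (hU : IsFrame r U) (hV : IsFrame r V) :
    IsOrthProj (tangentProj U V) where
  symm A B := by
    rw [inner_eq_sum_trace, inner_eq_sum_trace]
    refine Finset.sum_congr rfl fun k _ => ?_
    have hPs := IsFrame.proj_transpose U k
    have hQs := IsFrame.proj_transpose V k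
    rw [hat_tangentProj, hat_tangentProj]
    set P := hat U k * (hat U k)ᵀ
    set Q := hat V k * (hat V k)ᵀ
    simp only [transpose_add, transpose_sub, transpose_mul, hPs, hQs, Matrix.add_mul,
      Matrix.sub_mul, Matrix.mul_add, Matrix.mul_sub, trace_add, trace_sub]
    congr 1
    · congr 1
      · rw [Matrix.mul_assoc]
      · rw [Matrix.mul_assoc, trace_mul_comm, Matrix.mul_assoc]
    · rw [Matrix.mul_assoc, trace_mul_comm]
      simp only [Matrix.mul_assoc]
  idem A := by
    refine hat_ext fun k => ?_
    have hP := hU.proj_mul_proj k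
    have hQ := hV.proj_mul_proj k
    rw [hat_tangentProj, hat_tangentProj]
    set P := hat U k * (hat U k)ᵀ
    set Q := hat V k * (hat V k)ᵀ
    have hP' : ∀ M : Matrix (Fin a) (Fin b) ℝ, P * (P * M) = P * M := fun M => by
      rw [← Matrix.mul_assoc, hP]
    simp only [Matrix.add_mul, Matrix.sub_mul, Matrix.mul_add, Matrix.mul_sub, Matrix.mul_assoc,
      hQ, hP']
    abel

end Slices

/-! ### Singular values of the slices -/

section SliceSigma

open Matrix

variable {a b c : ℕ}

/-- A vector supported in the `k`-th block. -/
def blockVec (k : Fin c) (u : EuclideanSpace ℝ (Fin a)) : EuclideanSpace ℝ (Fin a × Fin c) :=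
  WithLp.toLp 2 fun x => if x.2 = k then u x.1 else 0

theorem norm_blockVec (k : Fin c) (u : EuclideanSpace ℝ (Fin a)) : ‖blockVec k u‖ = ‖u‖ := by
  have h : ‖blockVec k u‖ ^ 2 = ‖u‖ ^ 2 := by
    rw [EuclideanSpace.norm_sq_eq, EuclideanSpace.norm_sq_eq, Fintype.sum_prod_type]
    refine Finset.sum_congr rfl fun i _ => ?_
    rw [Finset.sum_eq_single k]
    · simp [blockVec]
    · intro l _ hl
      simp [blockVec, hl]
    · simp
  exact (sq_eq_sq₀ (norm_nonneg _) (norm_nonneg _)).1 h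

theorem toEuclideanLin_blockDiagonal_blockVec (M : Fin c → Matrix (Fin a) (Fin b) ℝ) (k : Fin c)
    (u : EuclideanSpace ℝ (Fin b)) :
    toEuclideanLin (blockDiagonal M) (blockVec k u) = blockVec k (toEuclideanLin (M k) u) := by
  ext ⟨i, l⟩
  simp only [toLpLin_apply, mulVec, dotProduct, blockVec, blockDiagonal_apply,
    Fintype.sum_prod_type]
  by_cases h : l = k
  · subst h
    simp
  · simp [h]

/-- Testing the block diagonal matrix on vectors supported in one block passes its lower bound to
each slice. -/
theorem sigmaMin_mul_le (A : Tensor a b c) (k : Fin c) (u : EuclideanSpace ℝ (Fin a)) :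
    sigmaMin A * ‖toEuclideanLin (hat A k)ᵀ u‖ ≤
      ‖toEuclideanLin (hat A k) (toEuclideanLin (hat A k)ᵀ u)‖ := by
  have h := minSingularValue_mul_norm_adjoint_le (toEuclideanLin (bdiag A)) (blockVec k u)
  rw [adjoint_toEuclideanLin, bdiag, blockDiagonal_transpose,
    toEuclideanLin_blockDiagonal_blockVec, toEuclideanLin_blockDiagonal_blockVec, norm_blockVec,
    norm_blockVec] at h
  exact h

theorem sigmaMin_mul_le_transpose (A : Tensor a b c) (k : Fin c) (u : EuclideanSpace ℝ (Fin b)) :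
    sigmaMin A * ‖toEuclideanLin (hat A k) u‖ ≤
      ‖toEuclideanLin (hat A k)ᵀ (toEuclideanLin (hat A k) u)‖ := by
  have h := minSingularValue_mul_norm_apply_le (toEuclideanLin (bdiag A)) (blockVec k u)
  rw [adjoint_toEuclideanLin, bdiag, blockDiagonal_transpose,
    toEuclideanLin_blockDiagonal_blockVec, toEuclideanLin_blockDiagonal_blockVec, norm_blockVec,
    norm_blockVec] at h
  exact h

theorem sigmaMin_pos {A : Tensor a b c} (hA : A ≠ 0) : 0 < sigmaMin A := by
  refine minSingularValue_pos fun h => hA (hat_ext fun k => ?_)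
  have h1 : bdiag A = 0 := by simpa using h
  have h2 : hat A k = 0 := by
    have h3 := congrArg (fun M => blockDiag M k) h1
    simp only [bdiag, blockDiag_blockDiagonal] at h3
    exact h3
  rw [h2, ← zero_smul ℝ (0 : Tensor a b c), hat_smul, zero_smul]

end SliceSigma

/-! ### Comparison of tangent spaces -/

section Tangent

open Matrix

variable {a b c : ℕ}

/-- Both factors of a point of multi-rank at most `r`. -/
structure IsFactored (r : Fin c → ℕ) (X : Tensor a b c) (U : Tensor a (maxRank r) c)
    (V : Tensor b (maxRank r) c) : Prop where
  left : IsFrame r U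
  right : IsFrame r V
  left_mul : ∀ k, hat U k * (hat U k)ᵀ * hat X k = hat X k
  mul_right : ∀ k, hat X k * (hat V k * (hat V k)ᵀ) = hat X k

variable {r : Fin c → ℕ}

theorem isFactored_of_eq {X : Tensor a b c} {U : Tensor a (maxRank r) c}
    {S : Tensor (maxRank r) (maxRank r) c} {V : Tensor b (maxRank r) c}
    (h : X = U ∗ₜ S ∗ₜ tr V) (hU : IsFrame r U) (hV : IsFrame r V) : IsFactored r X U V where
  left := hU
  right := hV
  left_mul k := by
    rw [h, hat_tprod, hat_tprod, ← Matrix.mul_assoc, ← Matrix.mul_assoc, hU.proj_mul]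
  mul_right k := by
    have h1 := congrArg Matrix.transpose (hV.proj_mul k)
    rw [transpose_mul, IsFrame.proj_transpose] at h1
    rw [h, hat_tprod, hat_tprod, hat_tr, Matrix.mul_assoc, h1]

theorem IsSkinnySVD.isFactored {X : Tensor a b c} {U : Tensor a (maxRank r) c}
    {S : Tensor (maxRank r) (maxRank r) c} {V : Tensor b (maxRank r) c}
    (h : IsSkinnySVD r X U S V) : IsFactored r X U V :=
  isFactored_of_eq h.eq h.left h.right

/-- The factorization gives one inclusion and equal rank gives equality. This is where it matters
that the target attains the multi-rank `r` exactly. -/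
theorem range_eq_of_rank {m n d : Type*} [Fintype m] [Fintype n] [Fintype d] [DecidableEq n]
    [DecidableEq d] [DecidableEq m] {A : Matrix m n ℝ} {U : Matrix m d ℝ} {T : Matrix d n ℝ}
    (h : A = U * T) (hr : A.rank = U.rank) :
    LinearMap.range (toEuclideanLin U) = LinearMap.range (toEuclideanLin A) := by
  refine (Submodule.eq_of_le_of_finrank_eq ?_ ?_).symm
  · rintro _ ⟨x, rfl⟩
    exact ⟨toEuclideanLin T x, by rw [h, toEuclideanLin_mul_apply]⟩
  · rw [finrank_range_toEuclideanLin, finrank_range_toEuclideanLin, hr]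

theorem range_mul_le {m n d : Type*} [Fintype n] [Fintype d] [DecidableEq n]
    [DecidableEq d] (U : Matrix m d ℝ) (T : Matrix d n ℝ) :
    LinearMap.range (toEuclideanLin (U * T)) ≤ LinearMap.range (toEuclideanLin U) := by
  rintro _ ⟨x, rfl⟩
  exact ⟨toEuclideanLin T x, by rw [toEuclideanLin_mul_apply]⟩

variable {X Y : Tensor a b c} {U U' : Tensor a (maxRank r) c} {V V' : Tensor b (maxRank r) c}
  {S : Tensor (maxRank r) (maxRank r) c}

/-- The row space estimate applied to transposed slices. `Y` only needs frames of multi-rank `r`, so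
iterates that lose rank in the truncation are covered. -/
theorem norm_left_proj_sub_le (hX : IsSkinnySVD r X U S V) (hY : IsFactored r Y U' V')
    (hσ : 0 < sigmaMin X) (k : Fin c) (x : EuclideanSpace ℝ (Fin a)) :
    ‖toEuclideanLin (hat U k * (hat U k)ᵀ - hat U' k * (hat U' k)ᵀ) x‖ ≤
      ‖X - Y‖ / sigmaMin X * ‖x‖ := by
  have hXf := hX.isFactored
  have hT := fun M : Matrix (Fin a) (Fin b) ℝ => fun P : Matrix (Fin a) (Fin a) ℝ =>
    fun (hs : Pᵀ = P) (h : P * M = M) => show Mᵀ * P = Mᵀ by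
      have h' := congrArg Matrix.transpose h
      rwa [transpose_mul, hs] at h'
  refine norm_proj_sub_le (X := (hat X k)ᵀ) (Y := (hat Y k)ᵀ) (IsFrame.proj_transpose U k)
    (hXf.left.proj_mul_proj k) (IsFrame.proj_transpose U' k) (hY.left.proj_mul_proj k) ?_ hσ ?_
    (hT _ _ (IsFrame.proj_transpose U k) (hXf.left_mul k))
    (hT _ _ (IsFrame.proj_transpose U' k) (hY.left_mul k)) ?_ (norm_nonneg _) ?_ x
  · rw [hXf.left.rank_proj, hY.left.rank_proj]
  · intro u
    simpa only [transpose_transpose] using sigmaMin_mul_le_transpose X k u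
  · rw [transpose_transpose]
    refine (range_mul_le _ _).trans (range_eq_of_rank (T := hat S k * (hat V k)ᵀ) ?_ ?_).le
    · rw [← Matrix.mul_assoc, ← hat_tr, ← hat_tprod, ← hat_tprod, ← hX.eq]
    · exact (congrFun hX.multiRank_eq k).trans (congrFun hX.multiRank_left k).symm
  · rw [← transpose_sub, frobSq_transpose, ← hat_sub]
    exact frobSq_hat_le _ _

theorem norm_right_proj_sub_le (hX : IsSkinnySVD r X U S V) (hY : IsFactored r Y U' V')
    (hσ : 0 < sigmaMin X) (k : Fin c) (x : EuclideanSpace ℝ (Fin b)) :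
    ‖toEuclideanLin (hat V k * (hat V k)ᵀ - hat V' k * (hat V' k)ᵀ) x‖ ≤
      ‖X - Y‖ / sigmaMin X * ‖x‖ := by
  have hXf := hX.isFactored
  refine norm_proj_sub_le (X := hat X k) (Y := hat Y k) (IsFrame.proj_transpose V k)
    (hXf.right.proj_mul_proj k) (IsFrame.proj_transpose V' k) (hY.right.proj_mul_proj k) ?_ hσ
    (sigmaMin_mul_le X k) (hXf.mul_right k) (hY.mul_right k) ?_ (norm_nonneg _) ?_ x
  · rw [hXf.right.rank_proj, hY.right.rank_proj]
  · refine (range_mul_le _ _).trans (range_eq_of_rank (T := (hat U k * hat S k)ᵀ) ?_ ?_).le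
    · conv_lhs => rw [hX.eq]
      rw [hat_tprod, hat_tprod, hat_tr, transpose_mul, transpose_transpose]
    · rw [rank_transpose]
      exact (congrFun hX.multiRank_eq k).trans (congrFun hX.multiRank_right k).symm
  · rw [← hat_sub]
    exact frobSq_hat_le _ _

theorem norm_one_sub_proj_transpose_le {n : ℕ} {W : Tensor n (maxRank r) c} (hW : IsFrame r W)
    (k : Fin c) (x : EuclideanSpace ℝ (Fin n)) :
    ‖toEuclideanLin (1 - hat W k * (hat W k)ᵀ)ᵀ x‖ ≤ 1 * ‖x‖ := by
  rw [transpose_sub, transpose_one, IsFrame.proj_transpose]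
  exact norm_one_sub_proj_le (IsFrame.proj_transpose W k) (hW.proj_mul_proj k) x

/-- The distance of the tangent projections. -/
theorem norm_tangentProj_sub_le (hX : IsSkinnySVD r X U S V) (hY : IsFactored r Y U' V')
    (hσ : 0 < sigmaMin X) (Z : Tensor a b c) :
    ‖tangentProj U' V' Z - tangentProj U V Z‖ ≤ 2 * (‖X - Y‖ / sigmaMin X) * ‖Z‖ := by
  set t := ‖X - Y‖ / sigmaMin X with ht
  have ht0 : 0 ≤ t := by positivity
  have hXf := hX.isFactored
  -- With column projections P, P' and row projections Q, Q' this is (P - P')Z(1 - Q) + (1 - P')Z(Q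
  -- - Q'): each term has one small factor and one contraction.
  have e : tangentProj U V Z - tangentProj U' V' Z =
      (U ∗ₜ tr U - U' ∗ₜ tr U') ∗ₜ (Z - Z ∗ₜ (V ∗ₜ tr V)) +
        (Z - U' ∗ₜ tr U' ∗ₜ Z) ∗ₜ (V ∗ₜ tr V - V' ∗ₜ tr V') := by
    refine hat_ext fun k => ?_
    simp only [hat_tangentProj, hat_sub, hat_add, hat_tprod, hat_tr, Matrix.sub_mul,
      Matrix.mul_sub, Matrix.mul_assoc]
    abel
  have h1 : ‖(U ∗ₜ tr U - U' ∗ₜ tr U') ∗ₜ (Z - Z ∗ₜ (V ∗ₜ tr V))‖ ≤ t * ‖Z‖ := by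
    refine norm_le_of_hat ht0 fun k => ?_
    rw [hat_tprod, hat_sub, hat_tprod, hat_tr, hat_tprod, hat_tr]
    refine (frobSq_mul_le (norm_left_proj_sub_le hX hY hσ k) _).trans ?_
    gcongr
    have h2 : hat (Z - Z ∗ₜ (V ∗ₜ tr V)) k = hat Z k * (1 - hat V k * (hat V k)ᵀ) := by
      rw [hat_sub, hat_tprod, hat_tprod, hat_tr, Matrix.mul_sub, Matrix.mul_one]
    rw [h2]
    simpa using frobSq_mul_le_right (norm_one_sub_proj_transpose_le hXf.right k) (hat Z k)
  have h2 : ‖(Z - U' ∗ₜ tr U' ∗ₜ Z) ∗ₜ (V ∗ₜ tr V - V' ∗ₜ tr V')‖ ≤ t * ‖Z‖ := by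
    refine norm_le_of_hat ht0 fun k => ?_
    rw [hat_tprod, hat_sub (V ∗ₜ tr V), hat_tprod, hat_tr, hat_tprod, hat_tr]
    refine (frobSq_mul_le_right (c := t) (fun x => ?_) _).trans ?_
    · rw [transpose_sub, IsFrame.proj_transpose, IsFrame.proj_transpose]
      exact norm_right_proj_sub_le hX hY hσ k x
    gcongr
    have h3 : hat (Z - U' ∗ₜ tr U' ∗ₜ Z) k = (1 - hat U' k * (hat U' k)ᵀ) * hat Z k := by
      rw [hat_sub, hat_tprod, hat_tprod, hat_tr, Matrix.sub_mul, Matrix.one_mul]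
    rw [h3]
    simpa using frobSq_mul_le (norm_one_sub_proj_le (IsFrame.proj_transpose U' k)
      (hY.left.proj_mul_proj k)) (hat Z k)
  rw [norm_sub_rev, e]
  refine (norm_add_le _ _).trans ((add_le_add h1 h2).trans (le_of_eq ?_))
  ring

/-- The normal component of the error is quadratically small. -/
theorem norm_error_sub_tangentProj_le (hX : IsSkinnySVD r X U S V) (hY : IsFactored r Y U' V')
    (hσ : 0 < sigmaMin X) :
    ‖(Y - X) - tangentProj U' V' (Y - X)‖ ≤ ‖X - Y‖ / sigmaMin X * ‖Y - X‖ := by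
  have hXf := hX.isFactored
  refine norm_le_of_hat (by positivity) fun k => ?_
  -- The normal part is (1 - P')(Y - X)(1 - Q'). As Y(1 - Q') = 0 and P X = X, the left factor may
  -- be replaced by P - P', so two small factors meet.
  have e : hat ((Y - X) - tangentProj U' V' (Y - X)) k =
      (hat U k * (hat U k)ᵀ - hat U' k * (hat U' k)ᵀ) *
        (hat (Y - X) k * (1 - hat V' k * (hat V' k)ᵀ)) := by
    have h1 := hXf.left_mul k
    have h2 := hY.left_mul k
    have h3 := hY.mul_right k
    rw [hat_sub, hat_tangentProj, hat_sub]
    set P := hat U k * (hat U k)ᵀ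
    set P' := hat U' k * (hat U' k)ᵀ
    set Q' := hat V' k * (hat V' k)ᵀ
    have h4 : P * (hat Y k * Q') = P * hat Y k := by rw [h3]
    simp only [Matrix.sub_mul, Matrix.mul_sub, Matrix.mul_one, Matrix.mul_assoc, h1, h2, h3,
      ← Matrix.mul_assoc P (hat X k)]
    abel
  rw [e]
  refine (frobSq_mul_le (norm_left_proj_sub_le hX hY hσ k) _).trans ?_
  gcongr
  simpa using frobSq_mul_le_right (norm_one_sub_proj_transpose_le hY.right k) (hat (Y - X) k)

end Tangent

/-! ### Best approximation by truncation -/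

section EckartYoung

open Matrix

theorem frobSq_mul_of_left {m n l : Type*} [Fintype m] [Fintype n] [Fintype l] [DecidableEq n]
    {U : Matrix m n ℝ} (hU : Uᵀ * U = 1) (M : Matrix n l ℝ) : frobSq (U * M) = frobSq M := by
  rw [frobSq, frobSq, transpose_mul, Matrix.mul_assoc, ← Matrix.mul_assoc Uᵀ, hU, Matrix.one_mul]

theorem frobSq_mul_of_right {m n l : Type*} [Fintype m] [Fintype n] [Fintype l] [DecidableEq n]
    {V : Matrix m n ℝ} (hV : Vᵀ * V = 1) (M : Matrix l n ℝ) : frobSq (M * Vᵀ) = frobSq M := by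
  rw [← frobSq_transpose, transpose_mul, transpose_transpose, frobSq_mul_of_left hV,
    frobSq_transpose]

/-- Keep the first `s` rows. -/
def truncRows {a b : ℕ} (s : ℕ) (S : Matrix (Fin a) (Fin b) ℝ) : Matrix (Fin a) (Fin b) ℝ :=
  Matrix.of fun i j => if i.val < s then S i j else 0

/-- The rearrangement inequality behind the best approximation property. -/
theorem sum_tail_le_sum_mul {a s : ℕ} {t w : Fin a → ℝ} (ht : Antitone t) (hw0 : ∀ i, 0 ≤ w i)
    (hw1 : ∀ i, w i ≤ 1) (hw : ∑ i, w i = a - s) :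
    ∑ i, (if i.val < s then 0 else t i) ≤ ∑ i, w i * t i := by
  have hsa : s ≤ a := by
    have : (0 : ℝ) ≤ a - s := hw ▸ Finset.sum_nonneg fun i _ => hw0 i
    exact_mod_cast sub_nonneg.1 this
  -- A threshold separating head and tail: the first tail value, or the last value when the tail is
  -- empty. Subtracting θ from every `t i` changes neither side's difference, since both weights
  -- have the same sum, and then each term has a sign.
  obtain ⟨θ, h1, h2⟩ : ∃ θ, (∀ i : Fin a, i.val < s → θ ≤ t i) ∧
      ∀ i : Fin a, ¬ i.val < s → t i ≤ θ := by
    rcases hsa.lt_or_eq with h | h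
    · refine ⟨t ⟨s, h⟩, fun i hi => ht (Fin.le_def.2 hi.le), fun i hi => ht (Fin.le_def.2 ?_)⟩
      exact not_lt.1 hi
    · by_cases ha : 0 < a
      · refine ⟨t ⟨a - 1, by omega⟩, fun i _ => ht (Fin.le_def.2 ?_), fun i hi => ?_⟩
        · have := i.isLt
          simp only
          omega
        · exact absurd i.isLt (by omega)
      · exact ⟨0, fun i _ => absurd i.isLt (by omega), fun i _ => absurd i.isLt (by omega)⟩
  have hsum : ∑ i : Fin a, (w i - (1 - if i.val < s then 1 else 0)) * θ = 0 := by
    rw [← Finset.sum_mul, Finset.sum_sub_distrib, Finset.sum_sub_distrib, card_filter_val_lt hsa,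
      hw]
    simp
  have hpos : 0 ≤ ∑ i : Fin a, (w i - (1 - if i.val < s then 1 else 0)) * (t i - θ) := by
    refine Finset.sum_nonneg fun i _ => ?_
    by_cases hi : i.val < s
    · rw [if_pos hi]
      exact mul_nonneg (by linarith [hw0 i]) (by linarith [h1 i hi])
    · rw [if_neg hi]
      exact mul_nonneg_of_nonpos_of_nonpos (by linarith [hw1 i]) (by linarith [h2 i hi])
  have e : ∑ i : Fin a, (w i - (1 - if i.val < s then 1 else 0)) * (t i - θ) =
      ∑ i, w i * t i - ∑ i, (if i.val < s then 0 else t i) -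
        ∑ i : Fin a, (w i - (1 - if i.val < s then 1 else 0)) * θ := by
    rw [← Finset.sum_sub_distrib, ← Finset.sum_sub_distrib]
    refine Finset.sum_congr rfl fun i _ => ?_
    split_ifs <;> ring
  rw [e, hsum] at hpos
  linarith

variable {a b : ℕ} {U : Matrix (Fin a) (Fin a) ℝ} {S : Matrix (Fin a) (Fin b) ℝ}
  {V : Matrix (Fin b) (Fin b) ℝ}

theorem antitone_row_sq (hdiag : ∀ i j, i.val ≠ j.val → S i j = 0)
    (hnonneg : ∀ i j, i.val = j.val → 0 ≤ S i j)
    (hanti : ∀ i i' j j', i.val = j.val → i'.val = j'.val → i.val ≤ i'.val → S i' j' ≤ S i j) :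
    Antitone fun i => ∑ j, S i j ^ 2 := by
  intro i i' hii
  have row : ∀ (i : Fin a) (h : i.val < b), ∑ j, S i j ^ 2 = S i ⟨i.val, h⟩ ^ 2 := by
    intro i h
    refine Finset.sum_eq_single _ (fun j _ hj => ?_) (by simp)
    rw [hdiag i j fun h' => hj (Fin.ext h'.symm)]
    simp
  change ∑ j, S i' j ^ 2 ≤ ∑ j, S i j ^ 2
  by_cases h' : i'.val < b
  · have h : i.val < b := lt_of_le_of_lt hii h'
    rw [row i h, row i' h']
    have := hnonneg i' ⟨i'.val, h'⟩ rfl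
    gcongr
    exact hanti _ _ _ _ rfl rfl hii
  · have h0 : ∑ j, S i' j ^ 2 = 0 := by
      refine Finset.sum_eq_zero fun j _ => ?_
      rw [hdiag i' j fun h'' => h' (h'' ▸ j.isLt)]
      simp
    rw [h0]
    positivity

/-- The Eckart-Young theorem, for the Frobenius norm: truncating a singular value decomposition to
rank `s` gives a best approximation among the matrices with columns in the range of an orthogonal
projection `P` of rank `s`. -/
theorem eckart_young (hU : Uᵀ * U = 1) (hV : Vᵀ * V = 1)
    (hdiag : ∀ i j, i.val ≠ j.val → S i j = 0) (hnonneg : ∀ i j, i.val = j.val → 0 ≤ S i j)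
    (hanti : ∀ i i' j j', i.val = j.val → i'.val = j'.val → i.val ≤ i'.val → S i' j' ≤ S i j)
    {P : Matrix (Fin a) (Fin a) ℝ} (hPs : Pᵀ = P) (hPi : P * P = P) {s : ℕ} (hPt : P.trace = s)
    {X : Matrix (Fin a) (Fin b) ℝ} (hPX : P * X = X) :
    frobSq (U * S * Vᵀ - U * truncRows s S * Vᵀ) ≤ frobSq (U * S * Vᵀ - X) := by
  have hU' : U * Uᵀ = 1 := mul_eq_one_comm.1 hU
  -- The complementary projection in the basis of left singular vectors; its diagonal entries lie in
  -- [0, 1], sum to a - s, and serve as the weights in the rearrangement inequality.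
  set K := Uᵀ * (1 - P) * U with hK
  have hPs' : (1 - P)ᵀ = 1 - P := by rw [transpose_sub, transpose_one, hPs]
  have hPi' : (1 - P) * (1 - P) = 1 - P := by
    rw [Matrix.mul_sub, Matrix.mul_one, Matrix.sub_mul, hPi, Matrix.one_mul, sub_self, sub_zero]
  have hKs : Kᵀ = K := by
    rw [hK, transpose_mul, transpose_mul, transpose_transpose, hPs', Matrix.mul_assoc]
  have hKi : K * K = K := by
    calc K * K = Uᵀ * (1 - P) * (U * Uᵀ) * (1 - P) * U := by rw [hK]; simp only [Matrix.mul_assoc]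
      _ = Uᵀ * ((1 - P) * (1 - P)) * U := by rw [hU', Matrix.mul_one, Matrix.mul_assoc Uᵀ]
      _ = K := by rw [hPi']
  have hKt : K.trace = a - s := by
    rw [hK, Matrix.mul_assoc, trace_mul_comm, Matrix.mul_assoc, hU', Matrix.mul_one, trace_sub,
      trace_one, hPt, Fintype.card_fin]
  have hKii : ∀ i, K i i ^ 2 ≤ K i i := by
    intro i
    have h1 : K i i = ∑ j, K i j ^ 2 := by
      conv_lhs => rw [← hKi, Matrix.mul_apply]
      refine Finset.sum_congr rfl fun j _ => ?_
      rw [sq]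
      congr 1
      exact congrFun (congrFun hKs i) j
    calc K i i ^ 2 ≤ ∑ j, K i j ^ 2 :=
          Finset.single_le_sum (f := fun j => K i j ^ 2) (fun _ _ => sq_nonneg _)
            (Finset.mem_univ i)
      _ = K i i := h1.symm
  have hrow : S * Sᵀ = diagonal fun i => ∑ j, S i j ^ 2 := by
    ext i i'
    rw [Matrix.mul_apply, diagonal_apply]
    split_ifs with h
    · subst h
      simp [sq]
    · refine Finset.sum_eq_zero fun j _ => ?_
      by_cases hij : i.val = j.val
      · rw [transpose_apply, hdiag i' j fun h' => h (Fin.ext (hij.trans h'.symm)), mul_zero]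
      · rw [hdiag i j hij, zero_mul]
  -- Applying 1 - P removes `X` and does not increase the norm; what remains is the trace of K S Sᵀ,
  -- with S Sᵀ diagonal.
  have hlow : ∑ i, K i i * ∑ j, S i j ^ 2 ≤ frobSq (U * S * Vᵀ - X) := by
    have h1 : (1 - P) * (U * S * Vᵀ - X) = (1 - P) * U * S * Vᵀ := by
      rw [Matrix.mul_sub, Matrix.sub_mul _ _ X, hPX, Matrix.one_mul, sub_self, sub_zero]
      simp only [Matrix.mul_assoc]
    have h2 : frobSq ((1 - P) * U * S * Vᵀ) = ∑ i, K i i * ∑ j, S i j ^ 2 := by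
      rw [frobSq_mul_of_right hV, frobSq]
      have h3 : ((1 - P) * U * S)ᵀ * ((1 - P) * U * S) = Sᵀ * (K * S) := by
        calc _ = Sᵀ * (Uᵀ * ((1 - P) * (1 - P)) * U * S) := by
              rw [transpose_mul, transpose_mul, hPs']
              simp only [Matrix.mul_assoc]
          _ = _ := by rw [hPi']
      rw [h3, trace_mul_comm, Matrix.mul_assoc, hrow]
      simp [Matrix.trace]
    rw [← h2, ← h1]
    simpa using frobSq_mul_le (norm_one_sub_proj_le hPs hPi) (U * S * Vᵀ - X)
  have hup : frobSq (U * S * Vᵀ - U * truncRows s S * Vᵀ) =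
      ∑ i : Fin a, (if i.val < s then 0 else ∑ j, S i j ^ 2) := by
    rw [← Matrix.sub_mul, ← Matrix.mul_sub, frobSq_mul_of_right hV, frobSq_mul_of_left hU,
      frobSq_eq_sum, Finset.sum_comm]
    refine Finset.sum_congr rfl fun i _ => ?_
    split_ifs with h <;> simp [truncRows, h]
  rw [hup]
  refine (sum_tail_le_sum_mul (antitone_row_sq hdiag hnonneg hanti) (fun i => ?_) (fun i => ?_)
    hKt).trans hlow
  · exact (sq_nonneg _).trans (hKii i)
  · change K i i ≤ 1
    nlinarith [hKii i]

end EckartYoung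

/-! ### The truncation of tensors -/

section Truncation

open Matrix

variable {a b c : ℕ}

/-- The selection of the first `s` coordinates. -/
def selection (a R s : ℕ) : Matrix (Fin a) (Fin R) ℝ :=
  Matrix.of fun i p => if i.val = p.val ∧ p.val < s then 1 else 0

theorem mul_selection_apply {m : Type*} {R s : ℕ} (M : Matrix m (Fin a) ℝ) (i : m) (p : Fin R) :
    (M * selection a R s) i p =
      if h : p.val < s ∧ p.val < a then M i ⟨p.val, h.2⟩ else 0 := by
  rw [Matrix.mul_apply]
  split_ifs with h
  · rw [Finset.sum_eq_single ⟨p.val, h.2⟩]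
    · simp [selection, h.1]
    · intro j _ hj
      have : ¬ j.val = p.val := fun h' => hj (Fin.ext h')
      simp [selection, this]
    · simp
  · refine Finset.sum_eq_zero fun j _ => ?_
    have : ¬ (j.val = p.val ∧ p.val < s) := fun h' => h ⟨h'.2, h'.1 ▸ j.isLt⟩
    simp [selection, this]

theorem selection_transpose_mul_apply {n : Type*} {R s : ℕ} (M : Matrix (Fin a) n ℝ) (p : Fin R)
    (j : n) : ((selection a R s)ᵀ * M) p j =
      if h : p.val < s ∧ p.val < a then M ⟨p.val, h.2⟩ j else 0 := by
  have h := mul_selection_apply (R := R) (s := s) Mᵀ j p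
  change ((selection a R s)ᵀ * M)ᵀ j p = _
  rw [transpose_mul, transpose_transpose, h]
  rfl

theorem selection_transpose_mul_self {R s : ℕ} (h : s ≤ a) :
    (selection a R s)ᵀ * selection a R s = diagonal fun p => if p.val < s then 1 else 0 := by
  ext p q
  rw [selection_transpose_mul_apply, diagonal_apply]
  by_cases hp : p.val < s
  · rw [dif_pos ⟨hp, hp.trans_le h⟩]
    by_cases hpq : p = q
    · subst hpq
      simp [selection, hp]
    · have : p.val ≠ q.val := fun h' => hpq (Fin.ext h')
      simp [selection, hpq, this]
  · rw [dif_neg fun h' => hp h'.1]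
    simp [hp]

theorem selection_mul_transpose {R s : ℕ} (h : s ≤ R) :
    selection a R s * (selection a R s)ᵀ = diagonal fun i => if i.val < s then 1 else 0 := by
  have e : ∀ (i : Fin a) (p : Fin R), selection a R s i p = (selection R a s)ᵀ i p := by
    intro i p
    simp only [selection, Matrix.of_apply, transpose_apply]
    congr 1
    refine propext ⟨fun h => ⟨h.1.symm, by omega⟩, fun h => ⟨h.1.symm, by omega⟩⟩
  have e' : selection a R s = (selection R a s)ᵀ := by
    ext i p
    exact e i p
  rw [e', transpose_transpose, selection_transpose_mul_self h]

variable {r : Fin c → ℕ}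

theorem hat_truncCols (U : Tensor a a c) (k : Fin c) :
    hat (truncCols r U) k = hat U k * selection a (maxRank r) (r k) := by
  ext i p
  rw [mul_selection_apply, truncCols, hat_idct]
  rfl

theorem hat_diag {S : Tensor a b c} (hS : IsDiagonal S) (k : Fin c) (i : Fin a) (j : Fin b)
    (h : i.val ≠ j.val) : hat S k i j = 0 := by
  change ∑ l, dctMatrix c k l * S (i, j, l) = 0
  simp [hS i j _ h]

/-- Cutting and padding become products with selection matrices, so the truncated factors multiply
back to a truncation inside the full decomposition. -/
theorem hat_truncDiag {S : Tensor a b c} (hS : IsDiagonal S) (k : Fin c) :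
    hat (truncDiag r S) k = (selection a (maxRank r) (r k))ᵀ * hat S k *
      selection b (maxRank r) (r k) := by
  ext p q
  rw [mul_selection_apply, truncDiag, hat_idct]
  simp only [slice, Matrix.of_apply, mk_apply, selection_transpose_mul_apply]
  by_cases h : p = q
  · subst h
    by_cases h1 : p.val < r k <;> by_cases h2 : p.val < a <;> by_cases h3 : p.val < b <;>
      simp [h1, h2, h3]
    rfl
  · rw [dif_neg fun h' => h h'.1]
    split_ifs
    · exact (hat_diag hS k _ _ fun h' => h (Fin.ext h')).symm
    · rfl
    · rfl

theorem IsOrthogonal.hat_transpose_mul {U : Tensor a a c} (hU : IsOrthogonal U) (k : Fin c) :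
    (hat U k)ᵀ * hat U k = 1 := by
  rw [← hat_tr, ← hat_tprod, hU.1, idTensor, hat_idct]
  ext i j
  rfl

theorem isFrame_truncCols {U : Tensor a a c} (hU : IsOrthogonal U) (hr : ∀ k, r k ≤ a) :
    IsFrame r (truncCols r U) := by
  refine hat_ext fun k => ?_
  rw [hat_tprod, hat_tr, hat_truncCols, transpose_mul, Matrix.mul_assoc,
    ← Matrix.mul_assoc (hat U k)ᵀ, hU.hat_transpose_mul, Matrix.one_mul,
    selection_transpose_mul_self (hr k), hat_partialId]

theorem diagonal_mul_mul_diagonal {M : Matrix (Fin a) (Fin b) ℝ}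
    (hM : ∀ i j, i.val ≠ j.val → M i j = 0) (s : ℕ) :
    (diagonal fun i : Fin a => if i.val < s then (1 : ℝ) else 0) * M *
      (diagonal fun j : Fin b => if j.val < s then (1 : ℝ) else 0) = truncRows s M := by
  ext i j
  rw [mul_diagonal, diagonal_mul, truncRows, Matrix.of_apply]
  by_cases h : i.val = j.val
  · rw [← h]
    split_ifs <;> simp
  · simp [hM i j h]

theorem IsTruncatedSVD.isFactored {W : Tensor a b c} {U : Tensor a (maxRank r) c}
    {S : Tensor (maxRank r) (maxRank r) c} {V : Tensor b (maxRank r) c}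
    (h : IsTruncatedSVD r W U S V) (ha : ∀ k, r k ≤ a) (hb : ∀ k, r k ≤ b) :
    IsFactored r (U ∗ₜ S ∗ₜ tr V) U V := by
  obtain ⟨U', S', V', hW, rfl, rfl, rfl⟩ := h
  exact isFactored_of_eq rfl (isFrame_truncCols hW.left ha) (isFrame_truncCols hW.right hb)

/-- The truncation is a best approximation of multi-rank `r`. -/
theorem IsTruncatedSVD.norm_sub_le {W X : Tensor a b c} {U : Tensor a (maxRank r) c}
    {S : Tensor (maxRank r) (maxRank r) c} {V : Tensor b (maxRank r) c}
    (h : IsTruncatedSVD r W U S V) {UX : Tensor a (maxRank r) c} {VX : Tensor b (maxRank r) c}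
    (hX : IsFactored r X UX VX) : ‖W - U ∗ₜ S ∗ₜ tr V‖ ≤ ‖W - X‖ := by
  obtain ⟨U', S', V', hW, rfl, rfl, rfl⟩ := h
  rw [← one_mul ‖W - X‖]
  refine norm_le_of_hat zero_le_one fun k => ?_
  have h1 : hat W k = hat U' k * hat S' k * (hat V' k)ᵀ := by
    rw [hW.eq, hat_tprod, hat_tprod, hat_tr]
  have h2 : hat (truncCols r U' ∗ₜ truncDiag r S' ∗ₜ tr (truncCols r V')) k =
      hat U' k * truncRows (r k) (hat S' k) * (hat V' k)ᵀ := by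
    rw [hat_tprod, hat_tprod, hat_tr, hat_truncCols, hat_truncCols, hat_truncDiag hW.diagonal,
      ← diagonal_mul_mul_diagonal (hat_diag hW.diagonal k),
      ← selection_mul_transpose (le_maxRank r k), ← selection_mul_transpose (le_maxRank r k), transpose_mul]
    simp only [Matrix.mul_assoc]
  rw [hat_sub, hat_sub, h1, h2, one_pow, one_mul]
  exact eckart_young (hW.left.hat_transpose_mul k) (hW.right.hat_transpose_mul k)
    (hat_diag hW.diagonal k) (fun i j => hW.nonneg i j k)
    (fun i i' j j' => hW.antitone i i' j j' k) (IsFrame.proj_transpose UX k)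
    (hX.left.proj_mul_proj k) (hX.left.trace_proj k) (hX.left_mul k)

end Truncation

/-! ### The sampling operator -/

section Sampling

variable {a b c m : ℕ} (Ω : Fin m → Fin a × Fin b × Fin c)

theorem inner_samplingOp (x y : Tensor a b c) :
    ⟪x, samplingOp Ω y⟫_ℝ = ∑ t, x (Ω t) * y (Ω t) := by
  simp [samplingOp, unitTensor, inner_sum, inner_smul_right, EuclideanSpace.inner_single_left,
    EuclideanSpace.inner_single_right, mul_comm]

theorem isPSD_samplingOp : IsPSD (samplingOp Ω) where
  symm x y := by
    rw [real_inner_comm, inner_samplingOp, inner_samplingOp]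
    exact Finset.sum_congr rfl fun t _ => mul_comm _ _
  nonneg x := by
    rw [inner_samplingOp]
    exact Finset.sum_nonneg fun t _ => mul_self_nonneg _
  cauchy_schwarz x y := by
    rw [inner_samplingOp, inner_samplingOp, inner_samplingOp]
    simpa only [sq] using Finset.sum_mul_sq_le_sq_mul_sq Finset.univ (fun t => x (Ω t))
      (fun t => y (Ω t))

/-- Tested on the unit tensor of a sampled index. It supplies 1 ≤ L, and later excludes log n = 0.
-/
theorem one_le_norm_samplingOp (hm : 0 < m) : 1 ≤ ‖samplingOp Ω‖ := by
  let t₀ : Fin m := ⟨0, hm⟩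
  have h1 : (1 : ℝ) ≤ ⟪unitTensor (Ω t₀), samplingOp Ω (unitTensor (Ω t₀))⟫_ℝ := by
    rw [inner_samplingOp]
    calc (1 : ℝ) = unitTensor (Ω t₀) (Ω t₀) * unitTensor (Ω t₀) (Ω t₀) := by simp [unitTensor]
      _ ≤ _ := Finset.single_le_sum
        (f := fun t => unitTensor (Ω t₀) (Ω t) * unitTensor (Ω t₀) (Ω t))
        (fun t _ => mul_self_nonneg _) (Finset.mem_univ t₀)
  have h2 : ‖unitTensor (Ω t₀)‖ = 1 := by simp [unitTensor]
  calc (1 : ℝ) ≤ _ := h1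
    _ ≤ ‖unitTensor (Ω t₀)‖ * ‖samplingOp Ω (unitTensor (Ω t₀))‖ := real_inner_le_norm _ _
    _ ≤ ‖unitTensor (Ω t₀)‖ * (‖samplingOp Ω‖ * ‖unitTensor (Ω t₀)‖) := by
      gcongr
      exact (samplingOp Ω).le_opNorm _
    _ = _ := by rw [h2]; ring

/-- Tested on the all-ones tensor, whose form value is `m`. Repeated indices are allowed, so the
rate may exceed 1 and needs this bound by L. -/
theorem rate_le_norm_samplingOp (hm : 0 < m) :
    (m : ℝ) / ((a : ℝ) * b * c) ≤ ‖samplingOp Ω‖ := by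
  have ha : 0 < a := (Ω ⟨0, hm⟩).1.pos
  have hb : 0 < b := (Ω ⟨0, hm⟩).2.1.pos
  have hc : 0 < c := (Ω ⟨0, hm⟩).2.2.pos
  let e : Tensor a b c := mk fun _ _ _ => 1
  have h1 : ⟪e, samplingOp Ω e⟫_ℝ = m := by
    rw [inner_samplingOp]
    simp [e]
  have h2 : ‖e‖ ^ 2 = (a : ℝ) * b * c := by
    rw [EuclideanSpace.norm_sq_eq]
    simp [e, mul_assoc]
  rw [div_le_iff₀ (by positivity), ← h1, ← h2]
  calc _ ≤ ‖e‖ * ‖samplingOp Ω e‖ := real_inner_le_norm _ _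
    _ ≤ ‖e‖ * (‖samplingOp Ω‖ * ‖e‖) := by gcongr; exact (samplingOp Ω).le_opNorm _
    _ = _ := by ring

end Sampling

/-! ### Convergence -/

section Convergence

variable {a b c m : ℕ} {Ω : Fin m → Fin a × Fin b × Fin c} {X : Tensor a b c} {r : Fin c → ℕ}
  {U : Tensor a (maxRank r) c} {S : Tensor (maxRank r) (maxRank r) c} {V : Tensor b (maxRank r) c}
  {k₁ k₂ : ℝ}

theorem IsSkinnySVD.rank_le_left (h : IsSkinnySVD r X U S V) (k : Fin c) : r k ≤ a := by
  rw [← congrFun h.multiRank_eq k]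
  exact (Matrix.rank_le_card_height (slice (dct X) k)).trans_eq (Fintype.card_fin a)

theorem IsSkinnySVD.rank_le_right (h : IsSkinnySVD r X U S V) (k : Fin c) : r k ≤ b := by
  rw [← congrFun h.multiRank_eq k]
  exact (Matrix.rank_le_card_width (slice (dct X) k)).trans_eq (Fintype.card_fin b)

theorem Run.isFactored (run : Run Ω X r k₁ k₂) (l : ℕ) :
    IsFactored r (run.iter l) (run.U l) (run.V l) := by
  cases l with
  | zero => exact run.init.isFactored
  | succ l =>
    rw [run.iter_succ]
    exact (run.trunc l).isFactored run.init.rank_le_left run.init.rank_le_right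

theorem hat_zero (k : Fin c) : hat (0 : Tensor a b c) k = 0 := by
  rw [← zero_smul ℝ (0 : Tensor a b c), hat_smul, zero_smul]

theorem IsFactored.eq_zero_of_rank {Y : Tensor a b c} (h : IsFactored r Y U V) (hr : ∀ k, r k = 0) :
    Y = 0 := by
  have h0 : maxRank r = 0 := by
    rw [maxRank, ← Nat.le_zero]
    exact Finset.sup_le fun k _ => (hr k).le
  have : IsEmpty (Fin (maxRank r)) := by rw [h0]; infer_instance
  refine hat_ext fun k => ?_
  rw [hat_zero, ← h.left_mul k]
  have h1 : hat U k * (hat U k).transpose = 0 := by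
    ext i j
    simp [Matrix.mul_apply]
  rw [h1, Matrix.zero_mul]

/-- A zero target has multi-rank 0, which forces every iterate to vanish. The case is separate
because there is no positive singular value to divide by. -/
theorem Run.iter_eq_zero (hX : IsSkinnySVD r X U S V) (run : Run Ω X r k₁ k₂) (h : X = 0) (l : ℕ) :
    run.iter l = 0 := by
  refine (run.isFactored l).eq_zero_of_rank fun k => ?_
  rw [← congrFun hX.multiRank_eq k, h]
  have h1 : slice (dct (0 : Tensor a b c)) k = 0 := hat_zero k
  rw [multiRank, h1, Matrix.rank_zero]

/-- The error after one step is at most twice the error before the truncation. -/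
theorem Run.norm_iter_succ_sub_le (hX : IsSkinnySVD r X U S V) (run : Run Ω X r k₁ k₂) (l : ℕ) :
    ‖run.iter (l + 1) - X‖ ≤ 2 * ‖(run.iter l - X) + run.α l • run.Q l‖ := by
  have h1 := (run.trunc l).norm_sub_le hX.isFactored
  rw [← run.iter_succ] at h1
  have h2 : (run.iter l - X) + run.α l • run.Q l = run.W l - X := by rw [run.W_eq]; abel
  have h3 : run.iter (l + 1) - X = (run.W l - X) - (run.W l - run.iter (l + 1)) := by abel
  rw [h2, h3]
  linarith [norm_sub_le (run.W l - X) (run.W l - run.iter (l + 1))]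

/-- The estimates for one step, under the assumption that the error has not increased. -/
theorem Run.step {p L ε : ℝ} (hX : IsSkinnySVD r X U S V) (run : Run Ω X r k₁ k₂) (hX0 : X ≠ 0)
    (hp : 0 < p) (hL : 1 ≤ L) (hpL : p ≤ L) (hε : 0 < ε) (hk₁ : 0 ≤ k₁) (hk₂ : 0 ≤ k₂)
    (hRL : ‖samplingOp Ω‖ ≤ L)
    (hrip : ‖tangentProj U V - p⁻¹ • (tangentProj U V ∘L samplingOp Ω ∘L tangentProj U V)‖ ≤ ε)
    (hD : 0 < (1 - 4 * ε) - k₁ * (1 + 4 * ε)) {l : ℕ}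
    (hδ : 2 * (‖X - run.iter l‖ / sigmaMin X) ≤ √p * ε / (L * (1 + ε))) :
    ‖(run.iter l - X) + run.α l • run.Q l‖ ≤
        (9 * ε - 5 * k₁ * ε * (1 + 4 * ε)) / ((1 - 4 * ε) - k₁ * (1 + 4 * ε)) *
          ‖run.iter l - X‖ +
        (4 * k₂ * ε + k₁ * k₂) / (1 - 4 * ε) *
          (p⁻¹ * (1 + 4 * ε / ((1 - 4 * ε) - k₁ * (1 + 4 * ε))) * ‖prevDir run.Q l‖) ∧
      p⁻¹ * (1 + 4 * ε / ((1 - 4 * ε) - k₁ * (1 + 4 * ε))) * ‖run.Q l‖ ≤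
        (1 + (9 * ε - 5 * k₁ * ε * (1 + 4 * ε)) / ((1 - 4 * ε) - k₁ * (1 + 4 * ε))) *
          ‖run.iter l - X‖ +
        (4 * k₂ * ε + k₁ * k₂) / (1 - 4 * ε) *
          (p⁻¹ * (1 + 4 * ε / ((1 - 4 * ε) - k₁ * (1 + 4 * ε))) * ‖prevDir run.Q l‖) := by
  have hσ := sigmaMin_pos hX0
  have hf := run.isFactored l
  have hP₀ := isOrthProj_tangentProj hX.isFactored.left hX.isFactored.right
  have hP := isOrthProj_tangentProj hf.left hf.right
  have hR := isPSD_samplingOp Ω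
  have hq : 0 < √p := Real.sqrt_pos.2 hp
  have hqp : √p ^ 2 = p := Real.sq_sqrt hp.le
  have hLs : 0 < L * (1 + ε) := by positivity
  have hw : 0 < √(L * (1 + ε)) := Real.sqrt_pos.2 hLs
  have hws : √(L * (1 + ε)) ^ 2 = L * (1 + ε) := Real.sq_sqrt hLs.le
  have hD0 : 0 ≤ 2 * (‖X - run.iter l‖ / sigmaMin X) := by positivity
  have hrip' : ∀ z, ‖tangentProj U V z -
      (√p ^ 2)⁻¹ • tangentProj U V (samplingOp Ω (tangentProj U V z))‖ ≤ ε * ‖z‖ := by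
    intro z
    rw [hqp]
    exact ContinuousLinearMap.le_of_opNorm_le _ hrip z
  obtain ⟨hM, h4⟩ := hP₀.rip_perturb hP hR hq hw hε rfl hws hL (hqp.le.trans hpL) hδ hRL
    (norm_tangentProj_sub_le hX hf hσ) hD0 hrip'
  -- The normal error carries t where the projections differ by 2t, hence the half of `D`.
  have hτ := (perturbation_constant_le hq hw hε rfl hws hL (hqp.le.trans hpL) hδ hD0).2
  rw [hqp] at h4 hτ
  rw [mul_div_cancel_left₀ _ (two_ne_zero)] at hτ
  have hG : run.G l = samplingOp Ω (-(run.iter l - X)) := by rw [run.G_eq, neg_sub]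
  refine step_estimates hP hp hε hk₁ hk₂ hD h4 hM (by positivity) (by positivity) hτ
    (norm_error_sub_tangentProj_le hX hf hσ) ?_ ?_ ?_ (b := run.β l)
  · rw [← hG]
    by_cases hl : l = 0
    · subst hl
      exact Or.inl run.β_zero
    · by_cases hk : KeepsDirection k₁ k₂ (tangentProj (run.U l) (run.V l) (run.G l))
        (tangentProj (run.U l) (run.V l) (prevDir run.Q l))
      · exact Or.inr ⟨hk, run.β_keep l hl hk⟩
      · exact Or.inl (run.β_restart l hk)
  · rw [← hG]
    exact run.Q_eq l
  · rw [← hG]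
    exact run.α_eq l

/-- The recursion runs on the errors and on the previous directions scaled by 2p⁻¹(1 + η). The
factor 2 from truncation doubles the step constant, so that the trace of the recursion is γ₁ and 2κ
is γ₂. -/
theorem Run.convergence {p L ε : ℝ} (hX : IsSkinnySVD r X U S V) (run : Run Ω X r k₁ k₂)
    (hX0 : X ≠ 0) (hp : 0 < p) (hL : 1 ≤ L) (hpL : p ≤ L) (hε : 0 < ε) (hk₁ : 0 ≤ k₁) (hk₂ : 0 ≤ k₂)
    (hRL : ‖samplingOp Ω‖ ≤ L)
    (hrip : ‖tangentProj U V - p⁻¹ • (tangentProj U V ∘L samplingOp Ω ∘L tangentProj U V)‖ ≤ ε)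
    (hD : 0 < (1 - 4 * ε) - k₁ * (1 + 4 * ε))
    (hδ : 2 * (‖run.iter 0 - X‖ / sigmaMin X) ≤ √p * ε / (L * (1 + ε)))
    (hv : vcg k₁ k₂ ε ≤ 1) (l : ℕ) :
    ‖run.iter l - X‖ ≤ vcg k₁ k₂ ε ^ l * ‖run.iter 0 - X‖ := by
  have hkε : 0 ≤ k₁ * (1 + 4 * ε) := by positivity
  have h4 : 0 < 1 - 4 * ε := by linarith
  have hκ : 0 ≤ (4 * k₂ * ε + k₁ * k₂) / (1 - 4 * ε) := by positivity
  have hA : 0 ≤ (9 * ε - 5 * k₁ * ε * (1 + 4 * ε)) / ((1 - 4 * ε) - k₁ * (1 + 4 * ε)) := by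
    refine div_nonneg ?_ hD.le
    nlinarith
  have hγ₁ : gamma₁ k₁ k₂ ε =
      2 * ((9 * ε - 5 * k₁ * ε * (1 + 4 * ε)) / ((1 - 4 * ε) - k₁ * (1 + 4 * ε))) +
        (4 * k₂ * ε + k₁ * k₂) / (1 - 4 * ε) := by
    rw [gamma₁]; ring
  have hγ₂ : gamma₂ k₁ k₂ ε = 2 * ((4 * k₂ * ε + k₁ * k₂) / (1 - 4 * ε)) := by
    rw [gamma₂]; ring
  have hγ₂0 : 0 ≤ gamma₂ k₁ k₂ ε := by rw [hγ₂]; positivity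
  have hvA := gamma₁_le_vcg hγ₂0
  have hv2 := vcg_sq hγ₂0
  rw [hγ₁] at hvA
  rw [hγ₁, hγ₂] at hv2
  have hσ := sigmaMin_pos hX0
  have step := fun (l : ℕ) (hl : ‖run.iter l - X‖ ≤ ‖run.iter 0 - X‖) =>
    run.step hX hX0 hp hL hpL hε hk₁ hk₂ hRL hrip hD (l := l) <| by
      refine le_trans ?_ hδ
      rw [norm_sub_rev]
      gcongr
  refine coupled_recursion_le (d := fun l => ‖run.iter l - X‖)
    (s := fun l => 2 * (p⁻¹ * (1 + 4 * ε / ((1 - 4 * ε) - k₁ * (1 + 4 * ε))) *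
      ‖prevDir run.Q l‖)) (mul_nonneg zero_le_two hA) hκ (by linarith) hv2 (norm_nonneg _) ?_ ?_ ?_
    hv l
  · simp [prevDir]
  · intro l hl
    have h1 := (step l hl).1
    have h2 := run.norm_iter_succ_sub_le hX l
    linarith
  · intro l hl
    have h1 := (step l hl).2
    change 2 * (p⁻¹ * (1 + 4 * ε / ((1 - 4 * ε) - k₁ * (1 + 4 * ε))) * ‖run.Q l‖) ≤ _
    linarith

end Convergence

end TensorRCG

end

/-! ### Assembly of the convergence statement and the facts about the constants -/

open TensorRCG Filter Topology in
theorem theorem3p1 :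
    -- convergence
    (∀ (n₁ n₂ n₃ m : ℕ) (_ : 0 < m) (Ω : Fin m → Fin n₁ × Fin n₂ × Fin n₃)
      (r : Fin n₃ → ℕ) (X : Tensor n₁ n₂ n₃) (U : Tensor n₁ (maxRank r) n₃)
      (S : Tensor (maxRank r) (maxRank r) n₃) (V : Tensor n₂ (maxRank r) n₃)
      (_ : IsSkinnySVD r X U S V)
      (p : ℝ) (_ : p = (m : ℝ) / ((n₁ : ℝ) * n₂ * n₃))
      (n : ℕ) (_ : n = max n₁ (max n₂ n₃))
      (β ε₀ k₁ k₂ : ℝ) (_ : 1 < β) (_ : 0 < ε₀) (_ : 0 ≤ k₁) (_ : 0 ≤ k₂)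
      (run : Run Ω X r k₁ k₂)
      (_ : ‖samplingOp Ω‖ ≤ 10 / 3 * β * Real.log n)
      (_ : ‖tangentProj U V - p⁻¹ • (tangentProj U V ∘L samplingOp Ω ∘L tangentProj U V)‖ ≤ ε₀)
      (_ : ‖run.iter 0 - X‖ / sigmaMin X ≤
        3 * Real.sqrt p * ε₀ / (20 * β * (1 + ε₀) * Real.log n))
      (_ : 0 < (1 - 4 * ε₀) - k₁ * (1 + 4 * ε₀))
      (_ : gamma₁ k₁ k₂ ε₀ + gamma₂ k₁ k₂ ε₀ < 1),
      vcg k₁ k₂ ε₀ < 1 ∧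
        ∀ l : ℕ, ‖run.iter l - X‖ ≤ vcg k₁ k₂ ε₀ ^ l * ‖run.iter 0 - X‖) ∧
    -- the case of no conjugation
    (∀ ε₀ : ℝ, 0 < ε₀ → 4 * ε₀ < 1 →
      vcg 0 0 ε₀ = 18 * ε₀ / (1 - 4 * ε₀) ∧
        (gamma₁ 0 0 ε₀ + gamma₂ 0 0 ε₀ < 1 → 18 * ε₀ / (1 - 4 * ε₀) < 1)) ∧
    -- the limit of the constants
    (∀ k₁ k₂ : ℝ, 0 ≤ k₁ → 0 ≤ k₂ → k₁ ≠ 1 →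
      Tendsto (fun ε₀ => gamma₁ k₁ k₂ ε₀ + gamma₂ k₁ k₂ ε₀) (𝓝 0) (𝓝 (3 * k₁ * k₂))) ∧
    (∀ k₁ k₂ : ℝ, 0 ≤ k₁ → 0 ≤ k₂ → k₁ * k₂ < 1 / 3 →
      ∀ᶠ ε₀ in 𝓝[>] 0, gamma₁ k₁ k₂ ε₀ + gamma₂ k₁ k₂ ε₀ < 1) ∧
    -- the standard parameters
    (∀ ε₀ : ℝ, 0 < ε₀ → ε₀ ≤ 0.01 →
      0 < (1 - 4 * ε₀) - 0.1 * (1 + 4 * ε₀) ∧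
        gamma₁ 0.1 1 ε₀ + gamma₂ 0.1 1 ε₀ < 1) := by
  refine ⟨?_, ?_, ?_, ?_, ?_⟩
  · intro n₁ n₂ n₃ m hm Ω r X U S V hX p hp n hn β ε₀ k₁ k₂ hβ hε hk₁ hk₂ run hR hrip hδ hD hγ
    have hkε : 0 ≤ k₁ * (1 + 4 * ε₀) := by positivity
    have h4 : 0 < 1 - 4 * ε₀ := by linarith
    have hγ₂ : 0 ≤ gamma₂ k₁ k₂ ε₀ := by unfold gamma₂; positivity
    have hv := vcg_lt_one hγ₂ hγ
    refine ⟨hv, fun l => ?_⟩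
    by_cases hX0 : X = 0
    · rw [run.iter_eq_zero hX hX0, run.iter_eq_zero hX hX0, hX0]
      simp
    have h1 : 0 < n₁ := (Ω ⟨0, hm⟩).1.pos
    have h2 : 0 < n₂ := (Ω ⟨0, hm⟩).2.1.pos
    have h3 : 0 < n₃ := (Ω ⟨0, hm⟩).2.2.pos
    have hp0 : 0 < p := by rw [hp]; positivity
    have hL1 := (one_le_norm_samplingOp Ω hm).trans hR
    have hpL := (rate_le_norm_samplingOp Ω hm).trans hR
    rw [← hp] at hpL
    refine run.convergence hX hX0 hp0 hL1 hpL hε hk₁ hk₂ hR hrip hD ?_ hv.le l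
    have hlog : Real.log n ≠ 0 := by
      rintro h
      rw [h] at hL1
      norm_num at hL1
    have hβ0 : β ≠ 0 := by positivity
    have hε1 : 1 + ε₀ ≠ 0 := by positivity
    -- With L = (10/3)β log n the doubled initial bound is exactly √p ε₀ / (L(1 + ε₀)), which
    -- explains the constant 3/20.
    refine (mul_le_mul_of_nonneg_left hδ zero_le_two).trans (le_of_eq ?_)
    field_simp
    norm_num
  · exact fun ε₀ h0 h1 => ⟨vcg_zero_zero h0 h1, fun h => by
      rw [← vcg_zero_zero h0 h1]
      exact vcg_lt_one (by simp [gamma₂]) h⟩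
  · exact fun k₁ k₂ _ _ h => tendsto_gamma h
  · exact fun k₁ k₂ _ _ h => eventually_gamma_lt_one h
  · exact fun ε₀ h0 h1 => standard_parameters h0 h1
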